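/- For a prime $p$ and $d \ge 3$ let $H_{p,d}$ be the Heisenberg group of $d\times d$ upper triangular matrices over $\mathbb{Z}/p\mathbb{Z}$ with ones on the diagonal. For a finite group $G$ and a multiset $Z$ of elements of $G$, consider the directed Cayley graph on $G$ with arcs $(g, gz)$, $g\in G$, $z\in Z$. Let $\mathcal{B}_Z(R)$ be the set of elements at directed graph distance at most $R$ from the identity, and for $\beta\in(0,1)$ let \[ \mathcal{D}_Z(\beta) := \min\{R \ge 0 : |\mathcal{B}_Z(R)| \ge \beta |G|\} \qquad (:=\infty \text{ if there is no such } R). \] Let $(k_N,p_N,d_N)_{N\in\mathbb{N}}$ be a sequence of triples of natural numbers with $p_N$ prime, $d_N\ge 3$, and, as $N\to\infty$, $k_N\to\infty$ and $k_N = o(d_N\log p_N)$. Put $G_N := H_{p_N,d_N}$ and \[ M^*_N := k_N\, p_N^{(d_N-1)/k_N}/e . \] (1) Assume in addition that $d_N^3 = o(k_N)$ and $d_N = o\big(p_N^{(d_N-1)/k_N}\big)$ (the latter holds for instance if $k_N \le \tfrac12 d_N\log p_N/\log d_N$ for all large $N$). Let $Z=[Z_1,\dots,Z_{k_N}]$ with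 $Z_1,\dots,Z_{k_N}$ independent and uniform on $G_N$. Then for every constant $\beta\in(0,1)$ we have $|\mathcal{D}_Z(\beta)-M^*_N|/M^*_N \to 0$ in probability as $N\to\infty$; that is, for every $\varepsilon>0$, with probability tending to $1$, $\mathcal{D}_Z(\beta)$ is finite and $|\mathcal{D}_Z(\beta)-M^*_N| \le \varepsilon M^*_N$. (2) The lower bound is deterministic and does not need the additional assumptions of (1): for all constants $\xi>0$ and $\beta\in(0,1)$ there is $N_0$ such that for all $N\ge N_0$ and every multiset $Z$ of $k_N$ elements of $G_N$ we have $\mathcal{D}_Z(\beta)\ge M^*_N(1-\xi)$. -/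

import Mathlib

open Filter Topology Asymptotics
open scoped ENNReal NNReal

/-- The Heisenberg group `H_{p,d}`: the `d × d` upper triangular matrices over `ℤ/pℤ` with ones on
the diagonal, as a subgroup of the invertible matrices. -/
def heisenbergGroup (p d : ℕ) : Subgroup (GL (Fin d) (ZMod p)) where
  carrier := {A | (∀ i, (A : Matrix (Fin d) (Fin d) (ZMod p)) i i = 1) ∧
    ∀ i j, j < i → (A : Matrix (Fin d) (Fin d) (ZMod p)) i j = 0}
  one_mem' := by
    refine ⟨fun i => by simp, fun i j h => ?_⟩
    simp [Matrix.one_apply_ne h.ne']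
  mul_mem' := by
    rintro A B ⟨hA1, hA0⟩ ⟨hB1, hB0⟩
    refine ⟨fun i => ?_, fun i j hij => ?_⟩
    · rw [Units.val_mul, Matrix.mul_apply, Finset.sum_eq_single i]
      · rw [hA1, hB1, one_mul]
      · intro j _ hj
        rcases lt_or_gt_of_ne hj with h | h
        · rw [hA0 i j h, zero_mul]
        · rw [hB0 j i h, mul_zero]
      · simp
    · rw [Units.val_mul, Matrix.mul_apply]
      refine Finset.sum_eq_zero fun l _ => ?_
      rcases lt_or_ge l i with h | h
      · rw [hA0 i l h, zero_mul]
      · rw [hB0 l j (hij.trans_le h), mul_zero]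
  inv_mem' := by
    rintro A ⟨hA1, hA0⟩
    have hT : Matrix.BlockTriangular
        ((A⁻¹ : GL (Fin d) (ZMod p)) : Matrix (Fin d) (Fin d) (ZMod p)) id := by
      have : Invertible (A : Matrix (Fin d) (Fin d) (ZMod p)) := A.invertible
      rw [Matrix.coe_units_inv]
      exact Matrix.blockTriangular_inv_of_blockTriangular (fun i j h => hA0 i j h)
    refine ⟨fun i => ?_, fun i j h => hT h⟩
    have h1 : ((A * A⁻¹ : GL (Fin d) (ZMod p)) : Matrix (Fin d) (Fin d) (ZMod p)) i i = 1 := by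
      simp
    rw [Units.val_mul, Matrix.mul_apply, Finset.sum_eq_single i] at h1
    · rwa [hA1, one_mul] at h1
    · intro j _ hj
      rcases lt_or_gt_of_ne hj with h | h
      · rw [hA0 i j h, zero_mul]
      · rw [hT h, mul_zero]
    · simp

/-- The directed Cayley graph of `G` generated by the multiset `Z`: the arcs are `(g, g * z)` for
`g ∈ G`, `z ∈ Z`. Distances do not see the multiplicities of the arcs. -/
def directedCayleyGraph {G : Type*} [Group G] (Z : Multiset G) : Digraph G where
  Adj g h := ∃ z ∈ Z, h = g * z

/-- `HasWalk Γ ℓ g h`: there is a directed walk of exactly `ℓ` arcs from `g` to `h` in `Γ`. -/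
inductive HasWalk {V : Type*} (Γ : Digraph V) : ℕ → V → V → Prop
  | nil (g : V) : HasWalk Γ 0 g g
  | snoc {ℓ : ℕ} {g h h' : V} : HasWalk Γ ℓ g h → Γ.Adj h h' → HasWalk Γ (ℓ + 1) g h'

/-- Directed graph distance: the least length of a directed walk from `g` to `h`
(`⊤` if there is none). -/
noncomputable def directedDist {V : Type*} (Γ : Digraph V) (g h : V) : ℕ∞ :=
  ⨅ (ℓ : ℕ) (_ : HasWalk Γ ℓ g h), (ℓ : ℕ∞)

/-- The ball of radius `R` around the identity in the directed Cayley graph generated by `Z`. -/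
def cayleyBall {G : Type*} [Group G] (Z : Multiset G) (R : ℝ≥0) : Set G :=
  {x | (directedDist (directedCayleyGraph Z) 1 x : ℝ≥0∞) ≤ (R : ℝ≥0∞)}

/-- The typical distance `D(β)`: the least radius `R ≥ 0` whose ball contains at least `β * |G|`
elements (`⊤` if no ball does). -/
noncomputable def typicalDistance {G : Type*} [Group G] (Z : Multiset G) (β : ℝ) : ℝ≥0∞ :=
  ⨅ (R : ℝ≥0) (_ : β * (Nat.card G : ℝ) ≤ ((cayleyBall Z R).ncard : ℝ)), (R : ℝ≥0∞)

/-- `M* = k * p ^ ((d - 1) / k) / e`. -/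
noncomputable def typicalRadius (k p d : ℕ) : ℝ :=
  (k : ℝ) * (p : ℝ) ^ (((d : ℝ) - 1) / (k : ℝ)) / Real.exp 1

/-- The probability that the multiset `[Z₁, …, Z_k]` satisfies `E` when `Z₁, …, Z_k` are independent
and uniform on the finite group `G`, that is, when `(Z₁, …, Z_k)` is uniform on `G ^ k`. -/
noncomputable def randomGeneratorsProb (G : Type*) (k : ℕ) (E : Multiset G → Prop) : ℝ :=
  ({Z : Fin k → G | E (Multiset.map Z Finset.univ.val)}.ncard : ℝ) / (Nat.card (Fin k → G) : ℝ)

/-! Put `x = p ^ ((d - 1) / k)`, so that `x ^ k = p ^ (d - 1)` is the number of possible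
superdiagonals, and `M* = k * x / e`. There are `(k + R).choose R` multisets of at most `R` letters
out of `k`. When `R` is much larger than `k` this is roughly `(e * R / k) ^ k`, which reaches `p ^
(d - 1)` near `R = M*`. The hypothesis `k = o(d log p)` makes `x` tend to infinity, so this regime
applies.

Lower bound: the superdiagonal is additive, so the superdiagonal of a word depends only on its
multiset of letters. A ball of radius `R` therefore meets at most `(k + R).choose R` fibres of the
superdiagonal (`le_choose_of_le_ncard_cayleyBall`).

Upper bound: a second moment argument (`card_small_image_le`) for an explicit family of words. Each
word is a sorted word of at most `R` letters, which supplies enough exponent vectors, followed by a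
short block word, which supplies enough orderings to spread over the whole group. The collisions of
two words over random generators are counted in three cases. If the exponents differ mod `p`, the
collision probability is at most `1 / |G|`. If they agree and the matrix of differences of pair
counts has rank at least `d`, it is at most `2 ^ d * p ^ (d - 1) / |G|`. The pairs of smaller rank
are so few that the trivial bound suffices (`card_small_rank_le`).

The collision probabilities come from Fox calculus: `w(A) - 1 = ∑ ∂ᵢw(A) * (Aᵢ - 1)`. Reading the
equation `w(A) = w'(A)` in row `a` and column `b`, the first column `e` where the rows of the
derivatives differ gives a nontrivial linear equation for the vector of entries at `(e, b)`. Its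
coefficients involve only columns before `b`. Revealing the entries column by column, upwards from
the diagonal, each such equation costs a factor `p`. -/

/-! ### Counting by revealing coordinates one at a time. -/

section PrefixCounting

variable {I V : Type*} [Fintype I] [DecidableEq I] [DecidableEq V]

/-- If the coordinates of the members of `S` are revealed in the order given by `ord`, and the
coordinate `i` can take at most `c i` values once the earlier ones are known, then `S` has at most
`∏ i, c i` members. -/
theorem card_le_prod_of_prefix (ord : I → ℕ) (hord : Function.Injective ord)
    (S : Finset (I → V)) (c : I → ℕ)
    (h : ∀ i, ∀ x ∈ S, ∃ A : Finset V, A.card ≤ c i ∧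
      ∀ y ∈ S, (∀ j, ord j < ord i → y j = x j) → y i ∈ A) :
    S.card ≤ ∏ i, c i := by
  classical
  -- Coordinates not yet revealed are masked by `none`, so the image is the set of prefixes known at
  -- time `n`.
  have key : ∀ n : ℕ, (S.image fun x i => if ord i < n then some (x i) else none).card ≤
      ∏ i ∈ Finset.univ.filter (fun i => ord i < n), c i := by
    intro n
    induction n with
    | zero =>
      simp only [not_lt_zero, if_false, Finset.filter_false, Finset.prod_empty]
      refine Finset.card_le_one.2 ?_
      simp only [Finset.mem_image]
      rintro a ⟨_, _, rfl⟩ b ⟨_, _, rfl⟩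
      rfl
    | succ n ih =>
      set S' := S.image fun x i => if ord i < n + 1 then some (x i) else none with hS'
      let r : (I → Option V) → (I → Option V) := fun z i => if ord i < n then z i else none
      have himg : S'.image r = S.image fun x i => if ord i < n then some (x i) else none := by
        rw [hS', Finset.image_image]
        refine Finset.image_congr fun x _ => ?_
        funext i
        simp only [Function.comp, r]
        split_ifs <;> first | rfl | omega
      by_cases hi : ∃ i, ord i = n
      · obtain ⟨i, hi⟩ := hi
        have hprod : ∏ j ∈ Finset.univ.filter (fun j => ord j < n + 1), c j =
            c i * ∏ j ∈ Finset.univ.filter (fun j => ord j < n), c j := by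
          rw [← Finset.prod_insert (by simp [hi])]
          congr 1
          ext j
          simp only [Finset.mem_filter, Finset.mem_univ, true_and, Finset.mem_insert]
          constructor
          · intro hj
            rcases Nat.lt_succ_iff_lt_or_eq.1 hj with h1 | h1
            · exact Or.inr h1
            · exact Or.inl (hord (h1.trans hi.symm))
          · rintro (rfl | hj) <;> omega
        rw [hprod]
        -- `r` forgets the coordinate revealed at time `n`; each of its fibres has at most `c i`
        -- members.
        refine (Finset.card_le_mul_card_image (f := r) S' (c i) ?_).trans
          (Nat.mul_le_mul_left _ (himg ▸ ih))
        intro a ha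
        rw [himg, Finset.mem_image] at ha
        obtain ⟨x, hx, rfl⟩ := ha
        obtain ⟨A, hA, hyA⟩ := h i x hx
        refine le_trans (Finset.card_le_card_of_injOn (t := A.image some) (fun z => z i) ?_ ?_)
          (Finset.card_image_le.trans hA)
        · intro z hz
          simp only [Finset.coe_filter, Set.mem_ofPred_eq, hS', Finset.mem_image] at hz
          obtain ⟨⟨y, hy, rfl⟩, hzr⟩ := hz
          simp only [hi, Nat.lt_succ_self, if_true, Finset.coe_image, Set.mem_image]
          refine ⟨y i, hyA y hy fun j hj => ?_, rfl⟩
          have := congrFun hzr j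
          simp only [r] at this
          rw [if_pos (by omega), if_pos (by omega), if_pos (by omega)] at this
          exact Option.some.inj this
        · intro z hz z' hz' hzz'
          simp only [Finset.coe_filter, Set.mem_ofPred_eq, hS', Finset.mem_image] at hz hz'
          obtain ⟨⟨y, hy, rfl⟩, hzr⟩ := hz
          obtain ⟨⟨y', hy', rfl⟩, hzr'⟩ := hz'
          funext j
          rcases lt_trichotomy (ord j) n with hj | hj | hj
          · have := congrFun (hzr.trans hzr'.symm) j
            simpa [r, hj] using this
          · obtain rfl : j = i := hord (hj.trans hi.symm)
            exact hzz'
          · rw [if_neg (by omega), if_neg (by omega)]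
      · have hprod : Finset.univ.filter (fun j => ord j < n + 1) =
            Finset.univ.filter (fun j => ord j < n) := by
          ext j
          simp only [Finset.mem_filter, Finset.mem_univ, true_and]
          have : ord j ≠ n := fun h => hi ⟨j, h⟩
          omega
        rw [hprod]
        convert ih using 2
        refine Finset.image_congr fun x _ => ?_
        funext i
        have : ord i ≠ n := fun h => hi ⟨i, h⟩
        by_cases h1 : ord i < n
        · rw [if_pos (by omega), if_pos h1]
        · rw [if_neg (by omega), if_neg h1]
  have hbig : ∀ i, ord i < Finset.univ.sup ord + 1 := fun i =>
    Nat.lt_succ_of_le (Finset.le_sup (Finset.mem_univ i))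
  have := key (Finset.univ.sup ord + 1)
  simp only [hbig, if_true, Finset.filter_true] at this
  rwa [Finset.card_image_of_injective] at this
  intro x y hxy
  funext i
  exact Option.some.inj (congrFun hxy i)

end PrefixCounting

/-! ### Points on a hyperplane over a finite field. -/

section Hyperplane

variable {F ι : Type*} [Field F] [Fintype F] [DecidableEq F] [Fintype ι] [DecidableEq ι]

/-- The solutions of one nontrivial linear equation. -/
theorem card_hyperplane_mul_card (v : ι → F) (hv : v ≠ 0) (c : F) :
    (Finset.univ.filter fun y : ι → F => ∑ i, v i * y i = c).card * Fintype.card F ≤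
      Fintype.card F ^ Fintype.card ι := by
  obtain ⟨i, hi⟩ : ∃ i, v i ≠ 0 := by
    by_contra! h
    exact hv (funext h)
  have : (((Finset.univ.filter fun y : ι → F => ∑ i, v i * y i = c) ×ˢ
      (Finset.univ : Finset F))).card ≤ (Finset.univ : Finset (ι → F)).card := by
    -- The translates of the hyperplane along the `i`th axis are disjoint because `v i ≠ 0`.
    refine Finset.card_le_card_of_injOn (fun a => a.1 + (Pi.single i a.2 : ι → F)) (by simp) ?_
    rintro ⟨y, a⟩ hy ⟨y', a'⟩ hy' hyy'
    simp only [Finset.coe_product, Set.mem_prod, Finset.coe_filter, Finset.mem_univ, true_and,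
      Set.mem_ofPred_eq, Finset.coe_univ, Set.mem_univ, and_true] at hy hy'
    have h1 : ∑ j, v j * (y + (Pi.single i a : ι → F)) j =
        ∑ j, v j * (y' + (Pi.single i a' : ι → F)) j := by
      simp only at hyy'
      rw [hyy']
    simp only [Pi.add_apply, mul_add, Finset.sum_add_distrib, hy, hy', Pi.single_apply, mul_ite,
      mul_zero, Finset.sum_ite_eq', Finset.mem_univ, if_true, add_right_inj] at h1
    have ha : a = a' := mul_left_cancel₀ hi h1
    subst ha
    simpa using hyy'
  rw [Finset.card_product, Finset.card_univ, Finset.card_univ, Fintype.card_fun] at this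
  exact this

end Hyperplane

/-! ### Fox derivatives and pair counts of words. -/

section FoxCalculus

variable {ι : Type*} [DecidableEq ι] {m R : Type*} [Fintype m] [DecidableEq m] [CommRing R]

/-- The Fox derivative of the word `w` in the direction `i`, evaluated at the matrices `A`. -/
def foxDeriv (A : ι → Matrix m m R) (i : ι) : List ι → Matrix m m R
  | [] => 0
  | j :: w => (if j = i then 1 else 0) + A j * foxDeriv A i w

/-- The number of pairs of positions `s < t` of the word with letter `j` at `s` and `i` at `t`. -/
def pairCount (j i : ι) : List ι → ℕ
  | [] => 0
  | l :: w => (if l = j then w.count i else 0) + pairCount j i w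

/-- The fundamental formula of Fox calculus: the product telescopes letter by letter. It turns a
word equation into one that is linear in the last column involved. -/
theorem prod_map_sub_one_eq_sum_foxDeriv [Fintype ι] (A : ι → Matrix m m R) (w : List ι) :
    (w.map A).prod - 1 = ∑ i, foxDeriv A i w * (A i - 1) := by
  induction w with
  | nil => simp [foxDeriv]
  | cons j w ih =>
    simp only [foxDeriv, add_mul, Finset.sum_add_distrib, ite_mul, zero_mul, one_mul,
      Finset.sum_ite_eq, Finset.mem_univ, if_true, mul_assoc, ← Finset.mul_sum, ← ih,
      List.map_cons, List.prod_cons]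
    noncomm_ring

theorem pairCount_append (j i : ι) (u v : List ι) :
    pairCount j i (u ++ v) = pairCount j i u + u.count j * v.count i + pairCount j i v := by
  induction u with
  | nil => simp [pairCount]
  | cons l u ih =>
    simp only [List.cons_append, pairCount, ih, List.count_append, List.count_cons, beq_iff_eq]
    split_ifs <;> ring

end FoxCalculus

/-! ### Entries of Fox derivatives at unitriangular matrices. -/

section Unitriangular

variable {d : ℕ} {R : Type*} [CommRing R]

/-- Upper triangular with ones on the diagonal. -/
def IsUnitri (A : Matrix (Fin d) (Fin d) R) : Prop :=
  (∀ a, A a a = 1) ∧ ∀ a b, b < a → A a b = 0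

variable {ι : Type*} [DecidableEq ι] {A B : ι → Matrix (Fin d) (Fin d) R}

theorem foxDeriv_lower (hA : ∀ i, IsUnitri (A i)) (i : ι) (w : List ι) {a b : Fin d} (h : b < a) :
    foxDeriv A i w a b = 0 := by
  induction w generalizing a b with
  | nil => rfl
  | cons j w ih =>
    simp only [foxDeriv, Matrix.add_apply, Matrix.mul_apply]
    rw [Finset.sum_eq_zero, add_zero]
    · split_ifs
      · exact Matrix.one_apply_ne h.ne'
      · rfl
    · intro e _
      rcases lt_or_ge e a with he | he
      · rw [(hA j).2 a e he, zero_mul]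
      · rw [ih (h.trans_le he), mul_zero]

theorem foxDeriv_diag (hA : ∀ i, IsUnitri (A i)) (i : ι) (w : List ι) (a : Fin d) :
    foxDeriv A i w a a = (w.count i : R) := by
  induction w with
  | nil => simp [foxDeriv]
  | cons j w ih =>
    simp only [foxDeriv, Matrix.add_apply, Matrix.mul_apply]
    rw [Finset.sum_eq_single a, (hA j).1, ih, one_mul, List.count_cons]
    · by_cases h : j = i <;> simp [h, add_comm]
    · intro e _ he
      rcases lt_or_gt_of_ne he with he | he
      · rw [(hA j).2 a e he, zero_mul]
      · rw [foxDeriv_lower hA i w he, mul_zero]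
    · simp

/-- Each occurrence of `i` contributes the product of the letters before it, and superdiagonal
entries add up in such a product. Hence every earlier letter `j` contributes `A j a b` once. -/
theorem foxDeriv_superdiag [Fintype ι] (hA : ∀ i, IsUnitri (A i)) (i : ι) (w : List ι)
    {a b : Fin d} (hab : (a : ℕ) + 1 = b) :
    foxDeriv A i w a b = ∑ j, A j a b * (pairCount j i w : R) := by
  have hlt : a < b := Fin.lt_def.2 (by omega)
  induction w with
  | nil => simp [foxDeriv, pairCount]
  | cons j w ih =>
    simp only [foxDeriv, Matrix.add_apply, Matrix.mul_apply]
    rw [Finset.sum_eq_add a b hlt.ne, (hA j).1, ih, foxDeriv_diag hA, one_mul]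
    · have : (if j = i then (1 : Matrix (Fin d) (Fin d) R) else 0) a b = 0 := by
        split_ifs
        · exact Matrix.one_apply_ne hlt.ne
        · rfl
      rw [this, zero_add]
      simp only [pairCount, Nat.cast_add, mul_add, Finset.sum_add_distrib, Nat.cast_ite,
        Nat.cast_zero, mul_ite, mul_zero, Finset.sum_ite_eq, Finset.mem_univ, if_true]
      rw [add_comm]
    · intro e _ he
      rcases lt_or_ge e a with h | h
      · rw [(hA j).2 a e h, zero_mul]
      · have : b < e := by
          rw [Fin.lt_def]
          have h1 : (e : ℕ) ≠ a := fun h => he.1 (Fin.ext h)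
          have h2 : (e : ℕ) ≠ b := fun h => he.2 (Fin.ext h)
          rw [Fin.le_def] at h
          omega
        rw [foxDeriv_lower hA i w this, mul_zero]
    · simp
    · simp

/-- By triangularity the column `e` of a product involves only columns up to `e`. The coefficients
of the equation in column `b` are thus known before that column is revealed. -/
theorem foxDeriv_congr (hA : ∀ i, IsUnitri (A i)) (hB : ∀ i, IsUnitri (B i)) (b : Fin d)
    (h : ∀ i a e, e < b → A i a e = B i a e) (i : ι) (w : List ι) {a e : Fin d} (he : e < b) :
    foxDeriv A i w a e = foxDeriv B i w a e := by
  induction w generalizing a e with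
  | nil => rfl
  | cons j w ih =>
    simp only [foxDeriv, Matrix.add_apply, Matrix.mul_apply]
    congr 1
    refine Finset.sum_congr rfl fun f _ => ?_
    rcases lt_or_ge e f with hf | hf
    · rw [foxDeriv_lower hA i w hf, foxDeriv_lower hB i w hf, mul_zero, mul_zero]
    · rw [ih he, h j a f (hf.trans_lt he)]

/-- The linear relation satisfied by the entries at `(e, b)` of two solutions of the word equation
which agree at all the entries revealed before. -/
theorem sum_foxDeriv_sub_mul_eq_zero [Fintype ι] (hA : ∀ i, IsUnitri (A i))
    (hB : ∀ i, IsUnitri (B i)) (w w' : List ι)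
    (hAw : (w.map A).prod = (w'.map A).prod) (hBw : (w.map B).prod = (w'.map B).prod)
    {a e b : Fin d} (heb : e < b)
    (hcol : ∀ i a' e', e' < b → A i a' e' = B i a' e')
    (hrow : ∀ i e', e < e' → A i e' b = B i e' b)
    (hz : ∀ i e', e' < e → foxDeriv A i w a e' = foxDeriv A i w' a e') :
    ∑ i, (foxDeriv A i w a e - foxDeriv A i w' a e) * (B i e b - A i e b) = 0 := by
  have expand : ∀ C : ι → Matrix (Fin d) (Fin d) R, (w.map C).prod = (w'.map C).prod →
      ∑ i, ∑ e', (foxDeriv C i w a e' - foxDeriv C i w' a e') * (C i - 1) e' b = 0 := by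
    intro C hC
    have h1 : ∑ i, (foxDeriv C i w - foxDeriv C i w') * (C i - 1) = 0 := by
      simp only [sub_mul (foxDeriv C _ w), Finset.sum_sub_distrib]
      rw [← prod_map_sub_one_eq_sum_foxDeriv, ← prod_map_sub_one_eq_sum_foxDeriv, hC, sub_self]
    have h2 := congrFun (congrFun h1 a) b
    rw [Matrix.sum_apply] at h2
    simpa only [Matrix.mul_apply, Matrix.sub_apply (foxDeriv C _ w), Matrix.zero_apply] using h2
  rw [← sub_eq_zero.2 ((expand B hBw).trans (expand A hAw).symm), ← Finset.sum_sub_distrib]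
  refine Finset.sum_congr rfl fun i _ => ?_
  -- Only `e' = e` survives: before `e` the derivatives of the two words agree, between `e` and `b`
  -- the entries of `A` and `B` agree, and from `b` on the entries of `C i - 1` vanish.
  rw [← Finset.sum_sub_distrib, Finset.sum_eq_single e]
  · rw [← foxDeriv_congr hA hB b hcol i w heb, ← foxDeriv_congr hA hB b hcol i w' heb,
      Matrix.sub_apply, Matrix.sub_apply]
    ring
  · intro e' _ hne
    rcases lt_or_ge e' b with hlt | hge
    · rw [← foxDeriv_congr hA hB b hcol i w hlt, ← foxDeriv_congr hA hB b hcol i w' hlt]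
      rcases lt_or_gt_of_ne hne with h | h
      · rw [hz i e' h]
        simp
      · rw [Matrix.sub_apply, Matrix.sub_apply, hrow i e' h]
        simp
    · have : ∀ C : ι → Matrix (Fin d) (Fin d) R, (∀ i, IsUnitri (C i)) → (C i - 1) e' b = 0 := by
        intro C hC
        rw [Matrix.sub_apply]
        rcases hge.eq_or_lt with rfl | h
        · rw [(hC i).1, Matrix.one_apply_eq, sub_self]
        · rw [(hC i).2 _ _ h, Matrix.one_apply_ne h.ne', sub_self]
      rw [this A hA, this B hB]
      simp
  · simp

end Unitriangular

/-- A form of `card_le_prod_of_prefix` in which the coordinate `i` loses a factor `e i`. -/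
theorem card_mul_prod_le_of_prefix {I V : Type*} [Fintype I] [DecidableEq I] [DecidableEq V]
    (ord : I → ℕ) (hord : Function.Injective ord)
    (S : Finset (I → V)) (C : ℕ) (e : I → ℕ) (he : ∀ i, 0 < e i)
    (h : ∀ i, ∀ x ∈ S, ∃ A : Finset V, A.card * e i ≤ C ∧
      ∀ y ∈ S, (∀ j, ord j < ord i → y j = x j) → y i ∈ A) :
    S.card * ∏ i, e i ≤ C ^ Fintype.card I := by
  calc S.card * ∏ i, e i ≤ (∏ i, C / e i) * ∏ i, e i := by
        refine Nat.mul_le_mul_right _ (card_le_prod_of_prefix ord hord S _ fun i x hx => ?_)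
        obtain ⟨A, hA, hy⟩ := h i x hx
        exact ⟨A, (Nat.le_div_iff_mul_le (he i)).2 hA, hy⟩
    _ = ∏ i, C / e i * e i := Finset.prod_mul_distrib.symm
    _ ≤ ∏ _i : I, C := Finset.prod_le_prod' fun i _ => Nat.div_mul_le_self _ _
    _ = C ^ Fintype.card I := by simp

/-- The positions above the diagonal. -/
abbrev UpIdx (d : ℕ) : Type := {x : Fin d × Fin d // x.1 < x.2}

/-! ### Collision probability of two words. -/

section Words

variable {d : ℕ} {F : Type*} [Field F]

/-- The unitriangular matrix with the given entries above the diagonal. -/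
def unitriMat (x : UpIdx d → F) : Matrix (Fin d) (Fin d) F := fun a b =>
  if h : a < b then x ⟨(a, b), h⟩ else if a = b then 1 else 0

theorem unitriMat_of_lt (x : UpIdx d → F) {a b : Fin d} (h : a < b) :
    unitriMat x a b = x ⟨(a, b), h⟩ := by
  simp [unitriMat, h]

theorem isUnitri_unitriMat (x : UpIdx d → F) : IsUnitri (unitriMat x) :=
  ⟨fun a => by simp [unitriMat], fun a b h => by simp [unitriMat, h.not_gt, h.ne']⟩

variable {ι : Type*}

/-- The family of unitriangular matrices with the entries `x`. -/
def unitriFamily (x : UpIdx d → ι → F) (i : ι) : Matrix (Fin d) (Fin d) F :=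
  unitriMat fun j => x j i

theorem isUnitri_unitriFamily (x : UpIdx d → ι → F) (i : ι) : IsUnitri (unitriFamily x i) :=
  isUnitri_unitriMat _

theorem unitriFamily_of_lt (x : UpIdx d → ι → F) (i : ι) {a b : Fin d} (h : a < b) :
    unitriFamily x i a b = x ⟨(a, b), h⟩ i := unitriMat_of_lt _ h

theorem unitriFamily_congr {x y : UpIdx d → ι → F} (i : ι) {a b : Fin d}
    (h : ∀ h : a < b, x ⟨(a, b), h⟩ = y ⟨(a, b), h⟩) :
    unitriFamily x i a b = unitriFamily y i a b := by
  simp only [unitriFamily, unitriMat]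
  split_ifs with h1
  · rw [h h1]
  · rfl
  · rfl

/-- The entries are revealed column by column, from the diagonal upwards. -/
def revealOrder (x : UpIdx d) : ℕ := x.1.2 * d + (d - 1 - x.1.1)

theorem revealOrder_lt_of_col {x y : UpIdx d} (h : x.1.2 < y.1.2) :
    revealOrder x < revealOrder y := by
  unfold revealOrder
  have h1 : (x.1.2 : ℕ) + 1 ≤ y.1.2 := h
  have h2 := Nat.mul_le_mul_right d h1
  have := y.1.1.2
  rw [add_mul] at h2
  omega

theorem revealOrder_lt_of_row {x y : UpIdx d} (h : x.1.2 = y.1.2) (h' : y.1.1 < x.1.1) :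
    revealOrder x < revealOrder y := by
  unfold revealOrder
  rw [h]
  have h1 : (y.1.1 : ℕ) < x.1.1 := h'
  have := x.1.1.2
  omega

theorem revealOrder_injective : Function.Injective (revealOrder (d := d)) := by
  intro x y hxy
  rcases lt_trichotomy x.1.2 y.1.2 with h | h | h
  · exact absurd hxy (revealOrder_lt_of_col h).ne
  · rcases lt_trichotomy x.1.1 y.1.1 with h' | h' | h'
    · exact absurd hxy (revealOrder_lt_of_row h.symm h').ne'
    · exact Subtype.ext (Prod.ext h' h)
    · exact absurd hxy (revealOrder_lt_of_row h h').ne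
  · exact absurd hxy (revealOrder_lt_of_col h).ne'

variable [Fintype F] [DecidableEq F] [Fintype ι] [DecidableEq ι]

/-- The families on which the words `w` and `w'` agree. -/
def wordSolutions (d : ℕ) (F : Type*) [Field F] [Fintype F] [DecidableEq F] (w w' : List ι) :
    Finset (UpIdx d → ι → F) :=
  Finset.univ.filter fun x => (w.map (unitriFamily x)).prod = (w'.map (unitriFamily x)).prod

/-- The entry at `(e, b)` lies on a hyperplane once the earlier entries are known. -/
theorem exists_hyperplane_of_wordSolutions (w w' : List ι) {x : UpIdx d → ι → F}
    (hx : x ∈ wordSolutions d F w w') {a e b : Fin d} (heb : e < b)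
    (hz : ∀ i e', e' < e → foxDeriv (unitriFamily x) i w a e' = foxDeriv (unitriFamily x) i w' a e')
    (hne : ∃ i, foxDeriv (unitriFamily x) i w a e ≠ foxDeriv (unitriFamily x) i w' a e) :
    ∃ A : Finset (ι → F), A.card * Fintype.card F ≤ Fintype.card F ^ Fintype.card ι ∧
      ∀ y ∈ wordSolutions d F w w',
        (∀ j, revealOrder j < revealOrder ⟨(e, b), heb⟩ → y j = x j) → y ⟨(e, b), heb⟩ ∈ A := by
  set v : ι → F := fun i =>
    foxDeriv (unitriFamily x) i w a e - foxDeriv (unitriFamily x) i w' a e with hv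
  have hv0 : v ≠ 0 := by
    obtain ⟨i, hi⟩ := hne
    exact fun h => hi (sub_eq_zero.1 (congrFun h i))
  refine ⟨_, card_hyperplane_mul_card v hv0 (∑ i, v i * x ⟨(e, b), heb⟩ i), fun y hy hyx => ?_⟩
  simp only [wordSolutions, Finset.mem_filter, Finset.mem_univ, true_and] at hx hy ⊢
  have := sum_foxDeriv_sub_mul_eq_zero (isUnitri_unitriFamily x) (isUnitri_unitriFamily y) w w'
    hx hy heb (fun i a' e' he' => unitriFamily_congr i fun h =>
        (hyx ⟨(a', e'), h⟩ (revealOrder_lt_of_col he')).symm)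
      (fun i e' he' => unitriFamily_congr i fun h =>
        (hyx ⟨(e', b), h⟩ (revealOrder_lt_of_row rfl he')).symm) hz
  simp only [unitriFamily_of_lt _ _ heb, mul_sub, Finset.sum_sub_distrib] at this
  exact sub_eq_zero.1 this

/-- Two words whose exponents differ agree with the probability that two uniform elements do. -/
theorem card_wordSolutions_of_count_ne (w w' : List ι)
    (h : ∃ i, (w.count i : F) ≠ (w'.count i : F)) :
    (wordSolutions d F w w').card * Fintype.card F ^ Fintype.card (UpIdx d) ≤
      (Fintype.card F ^ Fintype.card ι) ^ Fintype.card (UpIdx d) := by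
  have := card_mul_prod_le_of_prefix revealOrder revealOrder_injective (wordSolutions d F w w')
    (Fintype.card F ^ Fintype.card ι) (fun _ => Fintype.card F) (fun _ => Fintype.card_pos) ?_
  · simpa using this
  rintro ⟨⟨a, b⟩, hab⟩ x hx
  -- The derivatives already differ on the diagonal, so `e = a` works and every position above the
  -- diagonal gains a factor.
  refine exists_hyperplane_of_wordSolutions w w' hx (a := a) hab (fun i e' he' => ?_) ?_
  · rw [foxDeriv_lower (isUnitri_unitriFamily x) i w he',
      foxDeriv_lower (isUnitri_unitriFamily x) i w' he']
  · obtain ⟨i, hi⟩ := h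
    refine ⟨i, ?_⟩
    rwa [foxDeriv_diag (isUnitri_unitriFamily x), foxDeriv_diag (isUnitri_unitriFamily x)]

/-- The difference of the pair counts of two words. -/
def pairMatrix (F : Type*) [Field F] (w w' : List ι) : Matrix ι ι F :=
  Matrix.of fun j i => (pairCount j i w : F) - (pairCount j i w' : F)

/-- The positions above the diagonal in given rows, counted column by column. -/
theorem card_filter_upIdx (P : Fin d → Prop) [DecidablePred P] :
    (Finset.univ.filter fun x : UpIdx d => P x.1.1).card =
      ∑ b : Fin d, ((Finset.Iio b).filter P).card := by
  rw [← Finset.card_sigma]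
  refine Finset.card_bij' (fun x _ => ⟨x.1.2, x.1.1⟩)
    (fun y hy => ⟨(y.2, y.1), ?_⟩) ?_ ?_ ?_ ?_
  · simp only [Finset.mem_sigma, Finset.mem_filter, Finset.mem_Iio] at hy
    exact hy.2.1
  · rintro ⟨⟨a, b⟩, h⟩ hx
    simp only [Finset.mem_filter, Finset.mem_univ, true_and] at hx
    simpa using ⟨h, hx⟩
  · rintro ⟨b, a⟩ hy
    simp only [Finset.mem_sigma, Finset.mem_filter, Finset.mem_Iio] at hy
    simpa using hy.2.2
  · intros
    rfl
  · intros
    rfl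

theorem card_filter_pos_row :
    (Finset.univ.filter fun x : UpIdx d => 0 < (x.1.1 : ℕ)).card = (d - 1) * (d - 2) / 2 := by
  rw [card_filter_upIdx fun a => 0 < (a : ℕ)]
  have : ∀ b : Fin d, ((Finset.Iio b).filter fun a : Fin d => 0 < (a : ℕ)).card = (b : ℕ) - 1 := by
    intro b
    have h1 := Finset.card_filter_add_card_filter_not (s := Finset.Iio b)
      (fun a : Fin d => 0 < (a : ℕ))
    rw [Fin.card_Iio] at h1
    rcases Nat.eq_zero_or_pos b with hb | hb
    · omega
    · have h2 : ((Finset.Iio b).filter fun a : Fin d => ¬ 0 < (a : ℕ)).card = 1 := by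
        rw [Finset.card_eq_one]
        refine ⟨⟨0, hb.trans b.2⟩, ?_⟩
        ext a
        simp only [Finset.mem_filter, Finset.mem_Iio, Finset.mem_singleton, Fin.lt_def, Fin.ext_iff]
        omega
      omega
  simp only [this]
  rw [Fin.sum_univ_eq_sum_range (fun b => b - 1) d]
  cases d with
  | zero => rfl
  | succ n =>
    rw [Finset.sum_range_succ']
    simp [Finset.sum_range_id]

theorem card_upIdx : Fintype.card (UpIdx d) = d * (d - 1) / 2 := by
  have := card_filter_upIdx (d := d) fun _ => True
  simp only [Finset.filter_true, Fin.card_Iio, Finset.card_univ] at this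
  rw [this, Fin.sum_univ_eq_sum_range (fun b => b) d, Finset.sum_range_id]

/-- The rows `a` whose superdiagonal entries are annihilated by `C`. -/
def badRows (C : Matrix ι ι F) (x : UpIdx d → ι → F) : Finset (Fin d) :=
  Finset.univ.filter fun a =>
    ∃ b, ∃ h : a < b, (a : ℕ) + 1 = b ∧ Matrix.vecMul (x ⟨(a, b), h⟩) C = 0

/-- With equal exponents the first possible difference in row `a` is at column `a + 1`, so a good
row `a` puts the entries of row `a + 1` on hyperplanes. A bad row gives up at most `d - 1` of these
equations. In exchange its superdiagonal vector lies in the left kernel of the pair matrix, which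
saves a factor `Fintype.card F ^ d` by `hC`. -/
theorem card_wordSolutions_badRows (w w' : List ι)
    (h : ∀ i, (w.count i : F) = (w'.count i : F))
    (hC : (Finset.univ.filter fun v : ι → F => Matrix.vecMul v (pairMatrix F w w') = 0).card *
      Fintype.card F ^ d ≤ Fintype.card F ^ Fintype.card ι) (B : Finset (Fin d)) 
    (hB : ∀ a ∈ B, (a : ℕ) + 1 < d) :
    ((wordSolutions d F w w').filter fun x => badRows (pairMatrix F w w') x = B).card *
      Fintype.card F ^ ((d - 1) * (d - 2) / 2) ≤
      (Fintype.card F ^ Fintype.card ι) ^ Fintype.card (UpIdx d) := by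
  set Q := Fintype.card F with hQ
  have hQ1 : 0 < Q := Fintype.card_pos
  let S1 : UpIdx d → Prop := fun x => x.1.1 ∈ B ∧ (x.1.1 : ℕ) + 1 = x.1.2
  let S2 : UpIdx d → Prop := fun x => ∃ a : Fin d, (a : ℕ) + 1 = x.1.1 ∧ a ∉ B
  classical
  -- `e x` is the exponent saved at `x`: `S1` marks the superdiagonal entries of bad rows, `S2` the
  -- entries directly below good rows.
  let e : UpIdx d → ℕ := fun x => if S1 x then d else if S2 x then 1 else 0
  have hsum : (d - 1) * (d - 2) / 2 ≤ ∑ x, e x := by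
    let T : UpIdx d → Prop := fun x => ∃ a ∈ B, (a : ℕ) + 1 = x.1.1
    -- Each row index other than zero would save one; `T` marks the savings that may be lost below
    -- bad rows, and the extra `d - 1` at `S1` pays for them.
    have hpt : ∀ x : UpIdx d, (if 0 < (x.1.1 : ℕ) then 1 else 0) + (d - 1) * (if S1 x then 1 else 0) ≤
        e x + (if T x then 1 else 0) := by
      intro x
      have hd : 0 < d := x.1.1.pos
      by_cases h1 : S1 x
      · have : (if 0 < (x.1.1 : ℕ) then 1 else 0) ≤ 1 := by split_ifs <;> omega
        simp only [e, h1, if_true]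
        omega
      · by_cases h0 : 0 < (x.1.1 : ℕ)
        · have : S2 x ∨ T x := by
            have ha : ((x.1.1 : ℕ) - 1) < d := by omega
            by_cases h : (⟨(x.1.1 : ℕ) - 1, ha⟩ : Fin d) ∈ B
            · exact Or.inr ⟨_, h, by simp only; omega⟩
            · exact Or.inl ⟨_, by simp only; omega, h⟩
          rcases this with h | h <;> simp [e, h1, h0, h]
        · simp [h1, h0]
    have hT : ∑ x : UpIdx d, (if T x then 1 else 0) ≤ (d - 1) * B.card := by
      rw [← Finset.card_filter]
      rcases Nat.eq_zero_or_pos d with rfl | hd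
      · simp
      have hcard : ((Finset.univ.erase (⟨0, hd⟩ : Fin d)) ×ˢ B).card = (d - 1) * B.card := by
        rw [Finset.card_product, Finset.card_erase_of_mem (Finset.mem_univ _), Finset.card_univ,
          Fintype.card_fin]
      rw [← hcard]
      refine Finset.card_le_card_of_injOn
        (fun x => (x.1.2, ⟨(x.1.1 : ℕ) - 1, by omega⟩)) ?_ ?_
      · rintro ⟨⟨r, b⟩, hrb⟩ hx
        simp only [Finset.coe_filter, Finset.mem_univ, true_and, Set.mem_ofPred_eq, T] at hx
        obtain ⟨a, ha, har⟩ := hx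
        have hrb' : (r : ℕ) < b := hrb
        simp only [Finset.coe_product, Set.mem_prod, Finset.mem_coe, Finset.mem_erase,
          Finset.mem_univ, and_true, Fin.ext_iff, ne_eq]
        refine ⟨by omega, ?_⟩
        convert ha
        omega
      · rintro ⟨⟨r, b⟩, hrb⟩ hx ⟨⟨r', b'⟩, hrb'⟩ hx' hxx'
        simp only [Finset.coe_filter, Finset.mem_univ, true_and, Set.mem_ofPred_eq, T] at hx hx'
        obtain ⟨a, ha, har⟩ := hx
        obtain ⟨a', ha', har'⟩ := hx'
        simp only [Prod.mk.injEq, Fin.ext_iff] at hxx'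
        refine Subtype.ext (Prod.ext (Fin.ext ?_) (Fin.ext hxx'.1))
        simp only
        omega
    have hS : B.card ≤ ∑ x : UpIdx d, (if S1 x then 1 else 0) := by
      rw [← Finset.card_filter]
      refine Finset.card_le_card_of_surjOn (fun x => x.1.1) fun a ha => ?_
      refine ⟨⟨(a, ⟨a + 1, hB a ha⟩), Fin.lt_def.2 (by simp)⟩, ?_, rfl⟩
      simpa [S1] using ha
    have hpt' := Finset.sum_le_sum fun (x : UpIdx d) (_ : x ∈ Finset.univ) => hpt x
    rw [Finset.sum_add_distrib, Finset.sum_add_distrib, ← Finset.card_filter, card_filter_pos_row,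
      ← Finset.mul_sum] at hpt'
    have := Nat.mul_le_mul_left (d - 1) hS
    omega
  have key := card_mul_prod_le_of_prefix revealOrder revealOrder_injective
    ((wordSolutions d F w w').filter fun x => badRows (pairMatrix F w w') x = B)
    (Q ^ Fintype.card ι) (fun x => Q ^ e x) (fun _ => pow_pos hQ1 _) ?_
  · rw [Finset.prod_pow_eq_pow_sum] at key
    exact (Nat.mul_le_mul_left _ (Nat.pow_le_pow_right hQ1 hsum)).trans key
  rintro ⟨⟨r, b⟩, hrb⟩ x hx
  rw [Finset.mem_filter] at hx
  obtain ⟨hxS, hxB⟩ := hx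
  by_cases h1 : S1 ⟨(r, b), hrb⟩
  · refine ⟨_, by simpa only [e, h1, if_true] using hC, fun y hy _ => ?_⟩
    rw [Finset.mem_filter] at hy
    have h2 : r ∈ badRows (pairMatrix F w w') y := hy.2.symm ▸ h1.1
    simp only [badRows, Finset.mem_filter, Finset.mem_univ, true_and] at h2 ⊢
    obtain ⟨b', hrb', hb', hb''⟩ := h2
    obtain rfl : b = b' := Fin.ext (h1.2.symm.trans hb')
    exact hb''
  by_cases h2 : S2 ⟨(r, b), hrb⟩
  · obtain ⟨a, har, haB⟩ := id h2
    have := exists_hyperplane_of_wordSolutions w w' hxS (a := a) hrb (fun i e' he' => ?_) ?_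
    · obtain ⟨A, hA, hyA⟩ := this
      refine ⟨A, by simpa only [e, h1, h2, if_true, if_false, pow_one] using hA,
        fun y hy hyx => hyA y (Finset.mem_filter.1 hy).1 hyx⟩
    · have hle : e' ≤ a := by
        have : (e' : ℕ) < r := he'
        simp only at har
        exact Fin.le_def.2 (by omega)
      rcases hle.lt_or_eq with hlt | rfl
      · rw [foxDeriv_lower (isUnitri_unitriFamily x) i w hlt,
          foxDeriv_lower (isUnitri_unitriFamily x) i w' hlt]
      · rw [foxDeriv_diag (isUnitri_unitriFamily x), foxDeriv_diag (isUnitri_unitriFamily x), h]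
    · by_contra! hcon
      refine haB (hxB ▸ ?_)
      simp only [badRows, Finset.mem_filter, Finset.mem_univ, true_and]
      have hlt : a < r := by
        simp only at har
        exact Fin.lt_def.2 (by omega)
      refine ⟨r, hlt, har, ?_⟩
      funext i
      have := hcon i
      rw [foxDeriv_superdiag (isUnitri_unitriFamily x) i w har,
        foxDeriv_superdiag (isUnitri_unitriFamily x) i w' har, ← sub_eq_zero,
        ← Finset.sum_sub_distrib] at this
      simpa only [Matrix.vecMul, dotProduct, pairMatrix, Matrix.of_apply, Pi.zero_apply, mul_sub,
        unitriFamily_of_lt _ _ hlt] using this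
  · refine ⟨Finset.univ, ?_, fun y _ _ => Finset.mem_univ _⟩
    simp [e, h1, h2, hQ]

/-- Two words with the same exponents whose pair counts are in general position agree with about
the probability that two uniform elements of the commutator subgroup do. -/
theorem card_wordSolutions_of_count_eq (w w' : List ι)
    (h : ∀ i, (w.count i : F) = (w'.count i : F))
    (hC : (Finset.univ.filter fun v : ι → F => Matrix.vecMul v (pairMatrix F w w') = 0).card *
      Fintype.card F ^ d ≤ Fintype.card F ^ Fintype.card ι) :
    (wordSolutions d F w w').card * Fintype.card F ^ ((d - 1) * (d - 2) / 2) ≤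
      2 ^ d * (Fintype.card F ^ Fintype.card ι) ^ Fintype.card (UpIdx d) := by
  have h1 : (wordSolutions d F w w').card =
      ∑ B : Finset (Fin d),
        ((wordSolutions d F w w').filter fun x => badRows (pairMatrix F w w') x = B).card :=
    Finset.card_eq_sum_card_fiberwise fun _ _ => Finset.mem_coe.2 (Finset.mem_univ _)
  rw [h1, Finset.sum_mul]
  -- The factor `2 ^ d` counts the possible sets of bad rows.
  refine (Finset.sum_le_card_nsmul _ _
    ((Fintype.card F ^ Fintype.card ι) ^ Fintype.card (UpIdx d)) fun B _ => ?_).trans_eq ?_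
  · by_cases hB : ∀ a ∈ B, (a : ℕ) + 1 < d
    · exact card_wordSolutions_badRows w w' h hC B hB
    · rw [Finset.filter_eq_empty_iff.2, Finset.card_empty, zero_mul]
      · exact Nat.zero_le _
      · rintro x _ rfl
        refine hB fun a ha => ?_
        simp only [badRows, Finset.mem_filter, Finset.mem_univ, true_and] at ha
        obtain ⟨b, _, hb, _⟩ := ha
        omega
  · simp

end Words

/-! ### Product sets, affine subspaces and families of small rank. -/

section AffineCounting

variable {F E Y : Type*} [Field F] [AddCommGroup E] [Module F E] [FiniteDimensional F E]
  [Fintype Y] [DecidableEq Y] {s : ℕ}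

/-- The vectors of `U` which vanish at the first `g` places. -/
def vanishingPart (U : Submodule F (Fin s → E)) (g : ℕ) : Submodule F (Fin s → E) where
  carrier := {u | u ∈ U ∧ ∀ h : Fin s, (h : ℕ) < g → u h = 0}
  add_mem' := fun ha hb => ⟨U.add_mem ha.1 hb.1, fun h hh => by
    rw [Pi.add_apply, ha.2 h hh, hb.2 h hh, add_zero]⟩
  zero_mem' := ⟨U.zero_mem, fun _ _ => rfl⟩
  smul_mem' := fun c _ ha => ⟨U.smul_mem c ha.1, fun h hh => by
    rw [Pi.smul_apply, ha.2 h hh, smul_zero]⟩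

/-- A product of finite sets meets a translate of a subspace of dimension `r` in at most as many
points as a product of `r` of the factors has. -/
theorem card_affine_inter_le [Nonempty Y] (y : Y → E) (hy : Function.Injective y)
    (U : Submodule F (Fin s → E)) (z : Fin s → E) (S : Finset (Fin s → Y))
    (hS : ∀ X ∈ S, (fun g => y (X g)) - z ∈ U) :
    S.card ≤ Fintype.card Y ^ Module.finrank F U := by
  set r : ℕ → ℕ := fun g => Module.finrank F (vanishingPart U g) with hr
  have hle : ∀ g, vanishingPart U (g + 1) ≤ vanishingPart U g := fun g u hu =>
    ⟨hu.1, fun h hh => hu.2 h (by omega)⟩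
  have hmono : ∀ g, r (g + 1) ≤ r g := fun g => Submodule.finrank_mono (hle g)
  have hsum : ∀ m, ∑ i ∈ Finset.range m, (r i - r (i + 1)) + r m = r 0 := by
    intro m
    induction m with
    | zero => simp
    | succ m ih =>
      rw [Finset.sum_range_succ]
      have := hmono m
      omega
  have hr0 : r 0 ≤ Module.finrank F U := Submodule.finrank_mono fun u hu => hu.1
  have key := card_le_prod_of_prefix (fun i : Fin s => (i : ℕ)) Fin.val_injective S
    (fun i => Fintype.card Y ^ (r i - r (i + 1))) ?_
  · rw [Finset.prod_pow_eq_pow_sum, Fin.sum_univ_eq_sum_range (fun i => r i - r (i + 1)) s] at key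
    refine key.trans (Nat.pow_le_pow_right Fintype.card_pos ?_)
    have := hsum s
    omega
  intro i x hx
  -- If the dimension does not drop at `i`, the earlier coordinates determine the coordinate `i`.
  -- Otherwise it is left free, which happens at most `finrank F U` times.
  by_cases h : r (i + 1) = r i
  · have heq : vanishingPart U (i + 1) = vanishingPart U i :=
      Submodule.eq_of_le_of_finrank_eq (hle i) h
    refine ⟨{x i}, by simp [h], fun x' hx' hxx' => ?_⟩
    have hmem : (fun g => y (x' g)) - (fun g => y (x g)) ∈ vanishingPart U i := by
      refine ⟨?_, fun g hg => ?_⟩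
      · have := U.sub_mem (hS x' hx') (hS x hx)
        rwa [sub_sub_sub_cancel_right] at this
      · rw [Pi.sub_apply, hxx' g hg, sub_self]
    rw [← heq] at hmem
    have := hmem.2 i (Nat.lt_succ_self _)
    rw [Pi.sub_apply, sub_eq_zero] at this
    exact Finset.mem_singleton.2 (hy this)
  · refine ⟨Finset.univ, ?_, fun _ _ _ => Finset.mem_univ _⟩
    rw [Finset.card_univ]
    have := hmono i
    exact Nat.le_self_pow (by omega) _

/-- Few families of points of a product set have small rank relative to a given family. -/
theorem card_small_rank_le [Nonempty Y] (y : Y → E) (hy : Function.Injective y) {n r : ℕ}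
    (z : Fin n → Fin s → E) (S : Finset (Fin n → Fin s → Y))
    (hS : ∀ X ∈ S, Module.finrank F
      (Submodule.span F (Set.range fun i => (fun g => y (X i g)) - z i)) < r) :
    S.card ≤ 2 ^ n * Fintype.card Y ^ (s * r + r * n) := by
  classical
  let D : (Fin n → Fin s → Y) → Fin n → Fin s → E := fun X i => (fun g => y (X i g)) - z i
  let P : Finset (Fin n) → (Fin n → Fin s → Y) → Prop := fun I X =>
    ∀ i, D X i ∈ Submodule.span F (D X '' I)
  -- Sort the families by a set `I` of at most `r` indices whose differences span all the others.
  have hcover : S ⊆ (Finset.univ.filter fun I : Finset (Fin n) => I.card ≤ r).biUnion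
      fun I => S.filter (P I) := by
    intro X hX
    obtain ⟨κ, a, ha, hspan, hlin⟩ := exists_linearIndependent' F (D X)
    have : Fintype κ := Fintype.ofInjective a ha
    simp only [Finset.mem_biUnion, Finset.mem_filter, Finset.mem_univ, true_and]
    refine ⟨Finset.univ.image a, ?_, hX, fun i => ?_⟩
    · rw [Finset.card_image_of_injective _ ha, Finset.card_univ, ← finrank_span_eq_card hlin, hspan]
      exact (hS X hX).le
    · rw [Finset.coe_image, Finset.coe_univ, Set.image_univ, ← Set.range_comp, hspan]
      exact Submodule.subset_span ⟨i, rfl⟩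
  have hpiece : ∀ I : Finset (Fin n), I.card ≤ r →
      (S.filter (P I)).card ≤ Fintype.card Y ^ (s * r + r * n) := by
    intro I hI
    -- The members of `I` are revealed first, with `s` free factors each. Every other member then
    -- lies in a translate of their span, which leaves at most `r` factors.
    have key := card_le_prod_of_prefix (fun i : Fin n => if i ∈ I then (i : ℕ) else n + i) ?_
      (S.filter (P I)) (fun i => Fintype.card Y ^ (if i ∈ I then s else r)) ?_
    · rw [Finset.prod_pow_eq_pow_sum] at key
      refine key.trans (Nat.pow_le_pow_right Fintype.card_pos ?_)
      calc ∑ i, (if i ∈ I then s else r) ≤ ∑ i, ((if i ∈ I then s else 0) + r) :=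
            Finset.sum_le_sum fun i _ => by split_ifs <;> omega
        _ = I.card * s + n * r := by simp [Finset.sum_add_distrib]
        _ ≤ s * r + r * n := by nlinarith
    · intro i j hij
      simp only at hij
      split_ifs at hij <;> exact Fin.ext (by omega)
    · intro i x hx
      by_cases hi : i ∈ I
      · exact ⟨Finset.univ, by simp [hi], fun _ _ _ => Finset.mem_univ _⟩
      · refine ⟨Finset.univ.filter fun X : Fin s → Y =>
          (fun g => y (X g)) - z i ∈ Submodule.span F (D x '' I), ?_, fun x' hx' hxx' => ?_⟩
        · refine (card_affine_inter_le y hy _ (z i) _ fun X hX =>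
            (Finset.mem_filter.1 hX).2).trans ?_
          rw [if_neg hi]
          refine Nat.pow_le_pow_right Fintype.card_pos ?_
          rw [← Finset.coe_image]
          exact (finrank_span_finset_le_card _).trans (Finset.card_image_le.trans hI)
        · rw [Finset.mem_filter] at hx' ⊢
          refine ⟨Finset.mem_univ _, ?_⟩
          have h1 : D x '' I = D x' '' I := by
            refine Set.image_congr fun j hj => ?_
            simp only [D]
            rw [hxx' j (by rw [if_pos (Finset.mem_coe.1 hj), if_neg hi]; omega)]
          rw [h1]
          exact hx'.2 i
  calc S.card ≤ _ := Finset.card_le_card hcover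
    _ ≤ (Finset.univ.filter fun I : Finset (Fin n) => I.card ≤ r).card *
        Fintype.card Y ^ (s * r + r * n) :=
      Finset.card_biUnion_le_card_mul _ _ _ fun I hI => hpiece I (Finset.mem_filter.1 hI).2
    _ ≤ _ := Nat.mul_le_mul_right _ ((Finset.card_le_univ _).trans_eq (by simp))

end AffineCounting

/-! ### Size of a left kernel in terms of the rank. -/

section Kernel

variable {F ι : Type*} [Field F] [Fintype F] [DecidableEq F] [Fintype ι] [DecidableEq ι]

theorem card_vecMul_eq_zero (C : Matrix ι ι F) {r : ℕ} (hr : r ≤ C.rank) :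
    (Finset.univ.filter fun v : ι → F => Matrix.vecMul v C = 0).card * Fintype.card F ^ r ≤
      Fintype.card F ^ Fintype.card ι := by
  classical
  have h1 : (Finset.univ.filter fun v : ι → F => Matrix.vecMul v C = 0).card =
      Fintype.card (LinearMap.ker C.vecMulLinear) := by
    rw [Fintype.card_of_subtype]
    intro v
    simp
  have h2 := LinearMap.finrank_range_add_finrank_ker C.vecMulLinear
  have h3 : Module.finrank F (LinearMap.range C.vecMulLinear) = C.rank := by
    rw [← Matrix.rank_transpose, Matrix.rank, Matrix.mulVecLin_transpose]
  rw [h1, Module.card_eq_pow_finrank (K := F), ← pow_add]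
  refine Nat.pow_le_pow_right Fintype.card_pos ?_
  rw [Module.finrank_fintype_fun_eq_card] at h2
  omega

end Kernel

/-! ### Letter counts and pair counts of block words. -/

section BlockWords

variable {ι : Type*} {s q K : ℕ}

/-- The word with `c + 1` letters `β g j` for each group `g`, where `x g = (j, c)`. -/
def slotWord (β : Fin s → Fin q → ι) (x : Fin s → Fin q × Fin K) : List ι :=
  (List.finRange s).flatMap fun g => List.replicate ((x g).2 + 1) (β g (x g).1)

/-- The slots of the list in order, with the letters `α m`, `α (m + 1)`, … before, between and
after them. -/
def blockWord (α : ℕ → ι) (β : Fin s → Fin q → ι) : ℕ → List (Fin s → Fin q × Fin K) → List ι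
  | m, [] => [α m]
  | m, x :: L => α m :: slotWord β x ++ blockWord α β (m + 1) L

theorem length_slotWord_le (β : Fin s → Fin q → ι) (x : Fin s → Fin q × Fin K) :
    (slotWord β x).length ≤ s * K := by
  rw [slotWord, List.length_flatMap, ← Fin.sum_univ_def]
  refine (Finset.sum_le_card_nsmul _ _ K fun g _ => ?_).trans_eq (by simp)
  rw [List.length_replicate]
  omega

theorem length_blockWord_le (α : ℕ → ι) (β : Fin s → Fin q → ι) (m : ℕ)
    (L : List (Fin s → Fin q × Fin K)) :
    (blockWord α β m L).length ≤ L.length * (s * K) + L.length + 1 := by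
  induction L generalizing m with
  | nil => simp [blockWord]
  | cons x L ih =>
    have := ih (m + 1)
    have := length_slotWord_le β x
    simp only [blockWord, List.cons_append, List.length_cons, List.length_append, add_mul]
    omega

variable [DecidableEq ι]

theorem count_slotWord {β : Fin s → Fin q → ι} (hβ : ∀ g j g' j', β g j = β g' j' → g = g' ∧ j = j')
    (x : Fin s → Fin q × Fin K) (g : Fin s) (j : Fin q) :
    (slotWord β x).count (β g j) = if (x g).1 = j then ((x g).2 : ℕ) + 1 else 0 := by
  rw [slotWord, List.count_flatMap, ← Fin.sum_univ_def, Finset.sum_eq_single g]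
  · by_cases h : (x g).1 = j
    · simp [h]
    · have : β g (x g).1 ≠ β g j := fun h' => h (hβ _ _ _ _ h').2
      simp [h, List.count_replicate, this]
  · intro g' _ hg'
    have : β g' (x g').1 ≠ β g j := fun h' => hg' (hβ _ _ _ _ h').1
    simp [List.count_replicate, this]
  · simp

theorem count_slotWord_eq_zero {β : Fin s → Fin q → ι} (x : Fin s → Fin q × Fin K) {a : ι}
    (ha : ∀ g j, a ≠ β g j) : (slotWord β x).count a = 0 := by
  rw [List.count_eq_zero, slotWord]
  simp only [List.mem_flatMap, List.mem_replicate, not_exists, not_and]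
  exact fun g _ _ => ha _ _

variable {α : ℕ → ι} {β : Fin s → Fin q → ι}

theorem count_blockWord {N : ℕ} (hα : ∀ i j, i ≤ N → j ≤ N → α i = α j → i = j)
    (hαβ : ∀ i, i ≤ N → ∀ g j, α i ≠ β g j) (L : List (Fin s → Fin q × Fin K)) (m i : ℕ)
    (hm : m + L.length ≤ N) (hi : i ≤ N) :
    (blockWord α β m L).count (α i) = if m ≤ i ∧ i ≤ m + L.length then 1 else 0 := by
  induction L generalizing m with
  | nil =>
    rw [blockWord, List.count_singleton]
    simp only [List.length_nil, add_zero] at hm ⊢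
    by_cases h : m = i
    · simp [h]
    · have h1 : α m ≠ α i := fun h' => h (hα _ _ hm hi h')
      have h2 : ¬ (m ≤ i ∧ i ≤ m) := by omega
      simp [h1, h2]
  | cons x L ih =>
    rw [List.length_cons] at hm ⊢
    rw [blockWord, List.cons_append, List.count_cons, List.count_append,
      count_slotWord_eq_zero x (hαβ i hi), ih (m + 1) (by omega)]
    by_cases h : m = i
    · have h2 : ¬ (m + 1 ≤ i ∧ i ≤ m + 1 + L.length) := by omega
      have h3 : m ≤ i ∧ i ≤ m + (L.length + 1) := by omega
      subst h
      simp
    · have h1 : α m ≠ α i := fun h' => h (hα _ _ (by omega) hi h')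
      have h2 : (m + 1 ≤ i ∧ i ≤ m + 1 + L.length) ↔ (m ≤ i ∧ i ≤ m + (L.length + 1)) := by omega
      simp only [beq_iff_eq, h1, if_false, h2]
      simp

theorem pairCount_eq_zero_of_notMem {i j : ι} {w : List ι} (h : i ∉ w) : pairCount j i w = 0 := by
  induction w with
  | nil => rfl
  | cons l w ih =>
    rw [List.mem_cons, not_or] at h
    simp [pairCount, ih h.2, List.count_eq_zero.2 h.2]

/-- Between the letters `α (m + i)` and `α (m + i + 1)` stand the letters of the slot `i`. -/
theorem pairCount_blockWord {N : ℕ} (hα : ∀ i j, i ≤ N → j ≤ N → α i = α j → i = j)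
    (hαβ : ∀ i, i ≤ N → ∀ g j, α i ≠ β g j) (g : Fin s) (j : Fin q)
    (L : List (Fin s → Fin q × Fin K)) (m : ℕ) (hm : m + L.length ≤ N) :
    pairCount (β g j) (α m) (blockWord α β m L) = 0 ∧
    ∀ i (hi : i < L.length),
      pairCount (β g j) (α (m + (i + 1))) (blockWord α β m L) =
        pairCount (β g j) (α (m + i)) (blockWord α β m L) + (slotWord β L[i]).count (β g j) := by
  have hcons : ∀ (x : Fin s → Fin q × Fin K) (L : List (Fin s → Fin q × Fin K)) (m a : ℕ),
      m + (L.length + 1) ≤ N → a ≤ N →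
      pairCount (β g j) (α a) (blockWord α β m (x :: L)) =
        (slotWord β x).count (β g j) * (if m + 1 ≤ a ∧ a ≤ m + 1 + L.length then 1 else 0) +
          pairCount (β g j) (α a) (blockWord α β (m + 1) L) := by
    intro x L m a hm ha
    rw [blockWord, List.cons_append, pairCount, if_neg (hαβ m (by omega) g j), zero_add,
      pairCount_append, count_blockWord hα hαβ L (m + 1) a (by omega) ha,
      pairCount_eq_zero_of_notMem (List.count_eq_zero.1 (count_slotWord_eq_zero x (hαβ a ha))),
      zero_add]
  induction L generalizing m with
  | nil => exact ⟨by simp [blockWord, pairCount], fun i hi => absurd hi (by simp)⟩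
  | cons x L ih =>
    rw [List.length_cons] at hm
    have h0 : pairCount (β g j) (α m) (blockWord α β (m + 1) L) = 0 := by
      refine pairCount_eq_zero_of_notMem (List.count_eq_zero.1 ?_)
      rw [count_blockWord hα hαβ L (m + 1) m (by omega) (by omega), if_neg (by omega)]
    obtain ⟨ih0, ih1⟩ := ih (m + 1) (by omega)
    refine ⟨?_, fun i hi => ?_⟩
    · rw [hcons x L m m hm (by omega), h0, if_neg (by omega), mul_zero]
    · rw [List.length_cons] at hi
      rw [hcons x L m _ hm (by omega), hcons x L m _ hm (by omega), if_pos (by omega)]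
      cases i with
      | zero =>
        rw [if_neg (by omega), add_zero, h0, zero_add, ih0]
        simp
      | succ i =>
        rw [if_pos (by omega)]
        have := ih1 i (by omega)
        rw [show m + (i + 1 + 1) = m + 1 + (i + 1) by ring, this,
          show m + (i + 1) = m + 1 + i by ring, List.getElem_cons_succ]
        ring

theorem pairCount_eq_zero_of_sorted [LinearOrder ι] {w : List ι} (hw : w.Pairwise (· ≤ ·))
    {i j : ι} (hij : i < j) : pairCount j i w = 0 := by
  induction w with
  | nil => rfl
  | cons l w ih =>
    rw [List.pairwise_cons] at hw
    rw [pairCount, ih hw.2, add_zero]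
    split_ifs with h
    · subst h
      exact List.count_eq_zero.2 fun h => (hw.1 i h).not_gt hij
    · rfl

end BlockWords

/-! ### Counting multisets of bounded size. -/

theorem Multiset.eq_map_some_add_replicate {ι : Type*} [DecidableEq ι] (W : Multiset (Option ι)) :
    W = (W.filterMap id).map some + Multiset.replicate (W.count none) none := by
  induction W using Multiset.induction with
  | empty => simp
  | cons a W ih =>
    cases a with
    | none =>
      rw [Multiset.filterMap_cons_none _ _ rfl, Multiset.count_cons_self, Multiset.replicate_succ,
        Multiset.add_cons, ← ih]
    | some i =>
      rw [Multiset.filterMap_cons_some id (some i) W rfl, Multiset.count_cons_of_ne (by simp),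
        Multiset.map_cons, Multiset.cons_add, ← ih]

/-- The multisets with at most `R` members. -/
theorem exists_finset_multiset_card_le (ι : Type*) [Fintype ι] (R : ℕ) :
    ∃ 𝒲 : Finset (Multiset ι), 𝒲.card = (Fintype.card ι + R).choose R ∧
      ∀ W, W ∈ 𝒲 ↔ W.card ≤ R := by
  classical
  -- Padding with `none` makes a multiset of at most `R` members one of exactly `R` members.
  refine ⟨(Finset.univ : Finset (Sym (Option ι) R)).image fun W => W.1.filterMap id, ?_,
    fun W => ?_⟩
  · rw [Finset.card_image_of_injective, Finset.card_univ, Sym.card_sym_eq_choose,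
      Fintype.card_option]
    · congr 1
      omega
    · intro W W' h
      simp only at h
      have h1 := Multiset.eq_map_some_add_replicate W.1
      have h2 := Multiset.eq_map_some_add_replicate W'.1
      have h3 := congrArg Multiset.card h1
      have h4 := congrArg Multiset.card h2
      rw [Multiset.card_add, Multiset.card_map, Multiset.card_replicate, W.2] at h3
      rw [Multiset.card_add, Multiset.card_map, Multiset.card_replicate, W'.2, ← h] at h4
      have h5 : W.1.count none = W'.1.count none := by omega
      exact Subtype.ext (by rw [h1, h2, h, h5])
  · simp only [Finset.mem_image, Finset.mem_univ, true_and]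
    constructor
    · rintro ⟨W, rfl⟩
      have h1 := congrArg Multiset.card (Multiset.eq_map_some_add_replicate W.1)
      rw [Multiset.card_add, Multiset.card_map, W.2] at h1
      omega
    · intro hW
      refine ⟨⟨W.map some + Multiset.replicate (R - W.card) none, ?_⟩, ?_⟩
      · rw [Multiset.card_add, Multiset.card_map, Multiset.card_replicate]
        omega
      · have h0 : ∀ m, Multiset.filterMap id (Multiset.replicate m (none : Option ι)) = 0 := by
          intro m
          induction m with
          | zero => simp
          | succ m ih => rw [Multiset.replicate_succ, Multiset.filterMap_cons_none _ _ rfl, ih]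
        simp only [Multiset.filterMap_add, Multiset.filterMap_map, h0, add_zero]
        exact Multiset.filterMap_some W

/-! ### The family of words and its expected number of collisions. -/

section RandomWords

variable {p : ℕ} [Fact p.Prime] {s q K n d : ℕ}

/-- The letters of one group of a slot. -/
def slotVector (p : ℕ) (x : Fin q × Fin K) : Fin q → ZMod p := Pi.single x.1 (((x.2 : ℕ) + 1 : ℕ) : ZMod p)

theorem natCast_injOn_lt {a b : ℕ} (ha : a < p) (hb : b < p) (h : (a : ZMod p) = b) : a = b := by
  rwa [ZMod.natCast_eq_natCast_iff', Nat.mod_eq_of_lt ha, Nat.mod_eq_of_lt hb] at h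

/-- As `K < p`, the multiplicities `1, …, K` are nonzero and distinct mod `p`, so the letter and its
multiplicity can be read off. -/
theorem slotVector_injective (hK : K < p) :
    Function.Injective (slotVector p : Fin q × Fin K → Fin q → ZMod p) := by
  have hne : ∀ c : Fin K, (((c : ℕ) + 1 : ℕ) : ZMod p) ≠ 0 := by
    intro c h
    have := natCast_injOn_lt (p := p) (a := c + 1) (b := 0) (by omega) (by omega) (by simpa using h)
    omega
  rintro ⟨j, c⟩ ⟨j', c'⟩ h
  simp only [slotVector] at h
  have hj : j = j' := by
    by_contra hj
    have := congrFun h j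
    rw [Pi.single_eq_same, Pi.single_eq_of_ne hj] at this
    exact hne c this
  subst hj
  have := natCast_injOn_lt (by omega) (by omega) (Pi.single_injective j h)
  exact Prod.ext rfl (Fin.ext (by simpa using this))

/-- The difference of the letters of two slots. -/
def slotDiff (p : ℕ) (t t' : Fin n → Fin s → Fin q × Fin K) (i : Fin n) :
    Fin s → Fin q → ZMod p :=
  (fun g => slotVector p (t i g)) - fun g => slotVector p (t' i g)

variable {ι : Type*} [LinearOrder ι]

/-- A sorted word followed by a block word. -/
def sortedBlockWord (α : ℕ → ι) (β : Fin s → Fin q → ι)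
    (ω : Multiset ι × (Fin n → Fin s → Fin q × Fin K)) : List ι :=
  ω.1.sort (· ≤ ·) ++ blockWord α β 0 (List.ofFn ω.2)

theorem count_sortedBlockWord (α : ℕ → ι) (β : Fin s → Fin q → ι)
    (ω : Multiset ι × (Fin n → Fin s → Fin q × Fin K)) (i : ι) :
    (sortedBlockWord α β ω).count i =
      ω.1.count i + (blockWord α β 0 (List.ofFn ω.2)).count i := by
  rw [sortedBlockWord, List.count_append, ← Multiset.coe_count i (Multiset.sort _ _),
    Multiset.sort_eq]

theorem length_sortedBlockWord_le (α : ℕ → ι) (β : Fin s → Fin q → ι)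
    (ω : Multiset ι × (Fin n → Fin s → Fin q × Fin K)) :
    (sortedBlockWord α β ω).length ≤ ω.1.card + (n * (s * K) + n + 1) := by
  rw [sortedBlockWord, List.length_append, Multiset.length_sort]
  have := length_blockWord_le α β 0 (List.ofFn ω.2)
  rw [List.length_ofFn] at this
  omega

variable [Fintype ι] {α : ℕ → ι} {β : Fin s → Fin q → ι}

/-- Take the rows of the `β` letters and the columns of the `α` letters. Consecutive columns differ
exactly by the slot between the two letters. The sorted part does not interfere: its `α` letters
precede its `β` letters, and its `β` letters add the same amount to every `α` column. -/
theorem finrank_span_slotDiff_le (hα : ∀ i j, i ≤ n → j ≤ n → α i = α j → i = j)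
    (hαβ : ∀ i, i ≤ n → ∀ g j, α i < β g j)
    (hβ : ∀ g j g' j', β g j = β g' j' → g = g' ∧ j = j')
    (ω ω' : Multiset ι × (Fin n → Fin s → Fin q × Fin K)) :
    Module.finrank (ZMod p) (Submodule.span (ZMod p) (Set.range (slotDiff p ω.2 ω'.2))) ≤
      (pairMatrix (ZMod p) (sortedBlockWord α β ω) (sortedBlockWord α β ω')).rank := by
  have hαβ' : ∀ i, i ≤ n → ∀ g j, α i ≠ β g j := fun i hi g j => (hαβ i hi g j).ne
  set C := (pairMatrix (ZMod p) (sortedBlockWord α β ω) (sortedBlockWord α β ω')).submatrix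
    (fun x : Fin s × Fin q => β x.1 x.2) (fun i : Fin (n + 1) => α i) with hC
  have hpc : ∀ (ω : Multiset ι × (Fin n → Fin s → Fin q × Fin K)) (g : Fin s) (j : Fin q)
      (i : ℕ), i ≤ n → pairCount (β g j) (α i) (sortedBlockWord α β ω) =
        ω.1.count (β g j) + pairCount (β g j) (α i) (blockWord α β 0 (List.ofFn ω.2)) := by
    intro ω g j i hi
    rw [sortedBlockWord, pairCount_append,
      pairCount_eq_zero_of_sorted (Multiset.pairwise_sort _ _) (hαβ i hi g j),
      count_blockWord hα hαβ' _ 0 i (by simp) hi, if_pos (by simpa using hi), mul_one, zero_add,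
      ← Multiset.coe_count _ (Multiset.sort _ _), Multiset.sort_eq]
  have hstep : ∀ (ω : Multiset ι × (Fin n → Fin s → Fin q × Fin K)) (g : Fin s) (j : Fin q)
      (i : Fin n), (pairCount (β g j) (α (i + 1)) (sortedBlockWord α β ω) : ZMod p) =
        pairCount (β g j) (α i) (sortedBlockWord α β ω) + slotVector p (ω.2 i g) j := by
    intro ω g j i
    have h1 := (pairCount_blockWord hα hαβ' g j (List.ofFn ω.2) 0 (by simp)).2 i (by simp)
    rw [zero_add, zero_add, List.getElem_ofFn, count_slotWord hβ] at h1
    rw [hpc ω g j _ (by omega), hpc ω g j _ (by omega), h1, slotVector, Pi.single_apply]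
    simp only [Fin.eta, eq_comm (a := j)]
    push_cast
    ring
  refine le_trans ?_ (Matrix.rank_submatrix_le _ _ _ : C.rank ≤ _)
  rw [Matrix.rank_eq_finrank_span_cols]
  refine le_trans ?_ (Submodule.finrank_map_le
    (LinearEquiv.curry (ZMod p) (ZMod p) (Fin s) (Fin q)).toLinearMap _)
  refine Submodule.finrank_mono (Submodule.span_le.2 ?_)
  rintro _ ⟨i, rfl⟩
  refine ⟨C.col i.succ - C.col i.castSucc, Submodule.sub_mem _ (Submodule.subset_span ⟨_, rfl⟩)
    (Submodule.subset_span ⟨_, rfl⟩), ?_⟩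
  funext g j
  have h1 := hstep ω g j i
  have h2 := hstep ω' g j i
  simp only [hC, pairMatrix, slotDiff, LinearEquiv.coe_coe, LinearEquiv.coe_curry,
    Function.curry_apply, Pi.sub_apply, Matrix.col_apply, Matrix.submatrix_apply, Matrix.of_apply,
    Fin.val_succ, Fin.val_castSucc, h1, h2]
  ring

/-- The number of coincidences, over all the families of unitriangular matrices, of two members of
the family of words. -/
theorem sum_card_wordSolutions_le (hα : ∀ i j, i ≤ n → j ≤ n → α i = α j → i = j)
    (hαβ : ∀ i, i ≤ n → ∀ g j, α i < β g j)
    (hβ : ∀ g j g' j', β g j = β g' j' → g = g' ∧ j = j')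
    (hK : K < p) (hqK : 0 < q * K) {R : ℕ} (hR : R < p) (𝒲 : Finset (Multiset ι))
    (h𝒲 : ∀ W ∈ 𝒲, W.card ≤ R) :
    (∑ ω ∈ 𝒲 ×ˢ (Finset.univ : Finset (Fin n → Fin s → Fin q × Fin K)),
      ∑ ω' ∈ 𝒲 ×ˢ (Finset.univ : Finset (Fin n → Fin s → Fin q × Fin K)),
        (wordSolutions d (ZMod p) (sortedBlockWord α β ω) (sortedBlockWord α β ω')).card) *
          p ^ (d * (d - 1) / 2) ≤
      (p ^ Fintype.card ι) ^ (d * (d - 1) / 2) *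
        ((𝒲.card * (q * K) ^ (s * n)) ^ 2 +
          𝒲.card * (q * K) ^ (s * n) * ((q * K) ^ (s * n) * (2 ^ d * p ^ (d - 1))) +
          𝒲.card * (q * K) ^ (s * n) *
            (2 ^ n * (q * K) ^ (s * d + d * n) * p ^ (d * (d - 1) / 2))) := by
  classical
  set Ω := 𝒲 ×ˢ (Finset.univ : Finset (Fin n → Fin s → Fin q × Fin K)) with hΩ
  have hp0 : 0 < p := (Fact.out : p.Prime).pos
  have hY : Fintype.card (Fin q × Fin K) = q * K := by simp
  have : Nonempty (Fin q × Fin K) := Fintype.card_pos_iff.1 (hY ▸ hqK)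
  have hT : Fintype.card (Fin n → Fin s → Fin q × Fin K) = (q * K) ^ (s * n) := by
    rw [Fintype.card_fun, Fintype.card_fun, hY, Fintype.card_fin, Fintype.card_fin, ← pow_mul]
  have hΩcard : Ω.card = 𝒲.card * (q * K) ^ (s * n) := by
    rw [hΩ, Finset.card_product, Finset.card_univ, hT]
  let E : (Multiset ι × (Fin n → Fin s → Fin q × Fin K)) →
      (Multiset ι × (Fin n → Fin s → Fin q × Fin K)) → Prop := fun ω ω' =>
    ∀ i, ((sortedBlockWord α β ω).count i : ZMod p) = (sortedBlockWord α β ω').count i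
  let B : (Fin n → Fin s → Fin q × Fin K) → (Fin n → Fin s → Fin q × Fin K) → Prop := fun t t' =>
    Module.finrank (ZMod p) (Submodule.span (ZMod p) (Set.range (slotDiff p t t'))) < d
  have hexp : d * (d - 1) / 2 = (d - 1) * (d - 2) / 2 + (d - 1) := by
    rcases d with _ | _ | d
    · rfl
    · rfl
    · simp only [show d + 1 + 1 - 1 = d + 1 from rfl,
        show d + 1 + 1 - 2 = d from rfl]
      rw [show (d + 1 + 1) * (d + 1) = (d + 1) * d + (d + 1) * 2 by ring,
        Nat.add_mul_div_right _ _ two_pos]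
  -- Relative to the probability `1 / |G|`: factor `1` if the exponents differ, `2 ^ d * p ^ (d -
  -- 1)` if they agree and the rank is at least `d`, and the trivial factor `|G|` if the rank is
  -- small.
  have hpair : ∀ ω ω', (wordSolutions d (ZMod p) (sortedBlockWord α β ω)
      (sortedBlockWord α β ω')).card * p ^ (d * (d - 1) / 2) ≤
      (p ^ Fintype.card ι) ^ (d * (d - 1) / 2) * (1 + (if E ω' ω then 2 ^ d * p ^ (d - 1) else 0) +
        if B ω'.2 ω.2 ∧ E ω' ω then p ^ (d * (d - 1) / 2) else 0) := by
    intro ω ω'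
    by_cases hE : E ω' ω
    · by_cases hB : B ω'.2 ω.2
      · have hBE : B ω'.2 ω.2 ∧ E ω' ω := ⟨hB, hE⟩
        rw [if_pos hBE]
        refine Nat.mul_le_mul ?_ (by omega) |>.trans (le_of_eq rfl)
        refine (Finset.card_le_univ _).trans_eq ?_
        rw [Fintype.card_fun, Fintype.card_fun, ZMod.card, card_upIdx]
      · have h2 : d ≤ (pairMatrix (ZMod p) (sortedBlockWord α β ω') (sortedBlockWord α β ω)).rank :=
          (not_lt.1 hB).trans (finrank_span_slotDiff_le hα hαβ hβ ω' ω)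
        have := card_wordSolutions_of_count_eq (d := d) (F := ZMod p) _ _ hE
          (card_vecMul_eq_zero _ h2)
        rw [ZMod.card, card_upIdx] at this
        rw [if_pos hE, hexp, pow_add p]
        have hsymm : wordSolutions d (ZMod p) (sortedBlockWord α β ω) (sortedBlockWord α β ω') =
            wordSolutions d (ZMod p) (sortedBlockWord α β ω') (sortedBlockWord α β ω) := by
          simp only [wordSolutions, eq_comm]
        rw [hsymm]
        rw [hexp] at this
        calc _ = _ * p ^ (d - 1) := (mul_assoc _ _ _).symm
          _ ≤ _ * p ^ (d - 1) := Nat.mul_le_mul_right _ this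
          _ = (p ^ Fintype.card ι) ^ ((d - 1) * (d - 2) / 2 + (d - 1)) *
              (2 ^ d * p ^ (d - 1)) := by ring
          _ ≤ _ := Nat.mul_le_mul_left _ (by omega)
    · have : ∃ i, ((sortedBlockWord α β ω).count i : ZMod p) ≠ (sortedBlockWord α β ω').count i := by
        by_contra! h
        exact hE fun i => (h i).symm
      have := card_wordSolutions_of_count_ne (d := d) _ _ this
      rw [ZMod.card, card_upIdx] at this
      refine this.trans (Nat.le_mul_of_pos_right _ (by omega))
  -- Once the slots are fixed, equal exponents determine the multiplicities of `W` mod `p`, hence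
  -- exactly, since they are at most `R < p`.
  have hE1 : ∀ ω t, (𝒲.filter fun W => E (W, t) ω).card ≤ 1 := by
    intro ω t
    refine Finset.card_le_one.2 fun W hW W' hW' => ?_
    rw [Finset.mem_filter] at hW hW'
    refine Multiset.ext.2 fun i => natCast_injOn_lt (p := p) ?_ ?_ ?_
    · exact (Multiset.count_le_card _ _).trans_lt ((h𝒲 W hW.1).trans_lt hR)
    · exact (Multiset.count_le_card _ _).trans_lt ((h𝒲 W' hW'.1).trans_lt hR)
    · have := (hW.2 i).trans (hW'.2 i).symm
      rw [count_sortedBlockWord, count_sortedBlockWord] at this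
      push_cast at this
      exact add_right_cancel this
  have hEsum : ∀ ω, (Ω.filter fun ω' => E ω' ω).card ≤ (q * K) ^ (s * n) := by
    intro ω
    refine (Finset.card_le_mul_card_image_of_maps_to (f := Prod.snd) (t := Finset.univ)
      (fun _ _ => Finset.mem_univ _) 1 fun t _ => ?_).trans_eq
      (by rw [one_mul, Finset.card_univ, hT])
    refine le_trans (Finset.card_le_card_of_injOn Prod.fst ?_ ?_) (hE1 ω t)
    · rintro ⟨W, t'⟩ hW
      simp only [hΩ, Finset.coe_filter, Finset.mem_filter, Finset.mem_product, Finset.mem_univ,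
        and_true, Set.mem_ofPred_eq] at hW ⊢
      obtain ⟨⟨h1, h2⟩, rfl⟩ := hW
      exact ⟨h1, h2⟩
    · rintro ⟨W, t1⟩ h1 ⟨W', t2⟩ h2 h
      simp only [Finset.coe_filter, Finset.mem_filter, Set.mem_ofPred_eq] at h1 h2
      exact Prod.ext h (h1.2.trans h2.2.symm)
  have hBsum : ∀ ω, (Ω.filter fun ω' => B ω'.2 ω.2 ∧ E ω' ω).card ≤
      2 ^ n * (q * K) ^ (s * d + d * n) := by
    intro ω
    have hS := card_small_rank_le (F := ZMod p) (slotVector p) (slotVector_injective hK)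
      (fun i g => slotVector p (ω.2 i g)) (r := d)
      (Finset.univ.filter fun t : Fin n → Fin s → Fin q × Fin K => B t ω.2)
      fun X hX => (Finset.mem_filter.1 hX).2
    rw [hY] at hS
    refine (Finset.card_le_mul_card_image_of_maps_to (f := Prod.snd)
      (t := Finset.univ.filter fun t : Fin n → Fin s → Fin q × Fin K => B t ω.2)
      (fun ω' h => ?_) 1 fun t _ => ?_).trans (by rwa [one_mul])
    · simp only [Finset.mem_filter, Finset.mem_univ, true_and] at h ⊢
      exact h.2.1
    refine le_trans (Finset.card_le_card_of_injOn Prod.fst ?_ ?_) (hE1 ω t)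
    · rintro ⟨W, t'⟩ hW
      simp only [hΩ, Finset.coe_filter, Finset.mem_filter, Finset.mem_product, Finset.mem_univ,
        and_true, Set.mem_ofPred_eq] at hW ⊢
      obtain ⟨⟨h1, _, h2⟩, rfl⟩ := hW
      exact ⟨h1, h2⟩
    · rintro ⟨W, t1⟩ h1 ⟨W', t2⟩ h2 h
      simp only [Finset.coe_filter, Finset.mem_filter, Set.mem_ofPred_eq] at h1 h2
      exact Prod.ext h (h1.2.trans h2.2.symm)
  rw [← hΩcard, Finset.sum_mul]
  refine (Finset.sum_le_card_nsmul _ _ ((p ^ Fintype.card ι) ^ (d * (d - 1) / 2) *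
    (Ω.card + (q * K) ^ (s * n) * (2 ^ d * p ^ (d - 1)) +
      2 ^ n * (q * K) ^ (s * d + d * n) * p ^ (d * (d - 1) / 2))) fun ω _ => ?_).trans_eq ?_
  · rw [Finset.sum_mul]
    refine (Finset.sum_le_sum fun ω' _ => hpair ω ω').trans ?_
    rw [← Finset.mul_sum, Finset.sum_add_distrib, Finset.sum_add_distrib, ← Finset.sum_filter,
      ← Finset.sum_filter, Finset.sum_const, Finset.sum_const, Finset.sum_const, smul_eq_mul,
      smul_eq_mul, smul_eq_mul, mul_one]
    refine Nat.mul_le_mul_left _ (Nat.add_le_add (Nat.add_le_add le_rfl ?_) ?_)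
    · exact Nat.mul_le_mul_right _ (hEsum ω)
    · exact Nat.mul_le_mul_right _ (hBsum ω)
  · rw [smul_eq_mul]
    ring

end RandomWords

/-! ### Second moment method for the size of an image. -/

section SecondMoment

variable {Θ Ω G : Type*} [DecidableEq G]

/-- Cauchy–Schwarz on the fibre sizes, whose squares add up to the number of colliding pairs. -/
theorem sq_card_le_card_image_mul_collisions (S : Finset Ω) (f : Ω → G) :
    S.card ^ 2 ≤ (S.image f).card * ∑ ω ∈ S, ∑ ω' ∈ S, if f ω = f ω' then 1 else 0 := by
  classical
  have h1 : S.card = ∑ g ∈ S.image f, (S.filter fun ω => f ω = g).card :=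
    Finset.card_eq_sum_card_image f S
  have h2 : ∑ ω ∈ S, ∑ ω' ∈ S, (if f ω = f ω' then 1 else 0) =
      ∑ g ∈ S.image f, (S.filter fun ω => f ω = g).card ^ 2 := by
    rw [← Finset.sum_fiberwise_of_maps_to (g := f) (t := S.image f)
      (fun ω hω => Finset.mem_image_of_mem f hω)]
    refine Finset.sum_congr rfl fun g _ => ?_
    rw [sq, ← smul_eq_mul, ← Finset.sum_const]
    refine Finset.sum_congr rfl fun ω hω => ?_
    rw [(Finset.mem_filter.1 hω).2, ← Finset.card_filter]
    simp only [eq_comm]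
  rw [h2, h1]
  exact sq_sum_le_card_mul_sum_sq

variable [Fintype Θ] [Fintype G]

/-- If two members of the family collide with a probability close to the least possible one, then
the image of the family is almost always large. -/
theorem card_small_image_le (S : Finset Ω) (hS : S.Nonempty) (φ : Θ → Ω → G) {η β : ℝ}
    (hβ0 : 0 < β) (hβ1 : β < 1)
    (hη : ((∑ ω ∈ S, ∑ ω' ∈ S, (Finset.univ.filter fun θ => φ θ ω = φ θ ω').card : ℕ) : ℝ) *
      Fintype.card G ≤ Fintype.card Θ * (S.card : ℝ) ^ 2 * (1 + η)) :
    ((Finset.univ.filter fun θ => ((S.image (φ θ)).card : ℝ) < β * Fintype.card G).card : ℝ) ≤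
      Fintype.card Θ * (η * (β / (1 - β))) := by
  classical
  set bad := Finset.univ.filter fun θ => ((S.image (φ θ)).card : ℝ) < β * Fintype.card G
  have hS0 : (0 : ℝ) < S.card := by exact_mod_cast hS.card_pos
  let Q : Θ → ℕ := fun θ => ∑ ω ∈ S, ∑ ω' ∈ S, if φ θ ω = φ θ ω' then 1 else 0
  have hQ : ∑ ω ∈ S, ∑ ω' ∈ S, (Finset.univ.filter fun θ => φ θ ω = φ θ ω').card =
      ∑ θ, Q θ := by
    simp only [Q, Finset.card_filter]
    rw [Finset.sum_comm]
    rw [Finset.sum_congr rfl fun ω' _ => Finset.sum_comm, Finset.sum_comm]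
    exact Finset.sum_congr rfl fun θ _ => Finset.sum_comm
  have hCS : ∀ θ, (S.card : ℝ) ^ 2 ≤ (S.image (φ θ)).card * (Q θ : ℝ) := fun θ => by
    exact_mod_cast sq_card_le_card_image_mul_collisions S (φ θ)
  -- Every `θ` has at least `|S|² / |G|` collisions, and a bad one at least `1 / β` times as many.
  -- As the average exceeds the minimum by a factor of at most `1 + η`, bad parameters are rare, as
  -- in Markov's inequality.
  have hpt : ∀ θ, (S.card : ℝ) ^ 2 * (1 + if θ ∈ bad then (1 / β - 1) else 0) ≤
      Q θ * Fintype.card G := by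
    intro θ
    have hQ0 : (0 : ℝ) ≤ Q θ := Nat.cast_nonneg _
    split_ifs with h
    · have h1 : ((S.image (φ θ)).card : ℝ) < β * Fintype.card G := (Finset.mem_filter.1 h).2
      have h2 := (hCS θ).trans (mul_le_mul_of_nonneg_right h1.le hQ0)
      rw [add_sub_cancel, mul_one_div, div_le_iff₀ hβ0]
      linarith
    · rw [add_zero, mul_one]
      refine (hCS θ).trans ?_
      rw [mul_comm]
      refine mul_le_mul_of_nonneg_left ?_ hQ0
      exact_mod_cast Finset.card_le_univ _
  have hsum := Finset.sum_le_sum fun θ (_ : θ ∈ Finset.univ) => hpt θ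
  rw [← Finset.mul_sum, ← Finset.sum_mul, Finset.sum_add_distrib, ← Finset.sum_filter,
    Finset.filter_mem_eq_inter, Finset.univ_inter, Finset.sum_const, Finset.sum_const,
    Finset.card_univ, nsmul_eq_mul, mul_one, nsmul_eq_mul] at hsum
  rw [hQ] at hη
  push_cast at hη
  have h3 := hsum.trans hη
  rw [mul_comm (Fintype.card Θ : ℝ), mul_assoc] at h3
  have h4 := le_of_mul_le_mul_left h3 (by positivity)
  have h5 : (bad.card : ℝ) * (1 / β - 1) ≤ Fintype.card Θ * η := by linarith
  have h6 : 1 / β - 1 = (1 - β) / β := by field_simp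
  have h7 : 0 < 1 - β := by linarith
  rw [h6] at h5
  calc (bad.card : ℝ) = bad.card * ((1 - β) / β) * (β / (1 - β)) := by field_simp
    _ ≤ Fintype.card Θ * η * (β / (1 - β)) :=
      mul_le_mul_of_nonneg_right h5 (div_pos hβ0 h7).le
    _ = _ := by ring

end SecondMoment

/-! ### Balls of the Cayley graph as sets of word values. -/

section Balls

variable {G : Type*} [Group G]

theorem hasWalk_of_list (Z : Multiset G) (l : List G) (hl : ∀ z ∈ l, z ∈ Z) :
    HasWalk (directedCayleyGraph Z) l.length 1 l.prod := by
  induction l using List.reverseRecOn with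
  | nil => exact HasWalk.nil 1
  | append_singleton l z ih =>
    rw [List.length_append, List.prod_append]
    refine HasWalk.snoc (ih fun y hy => hl y (by simp [hy])) ⟨z, hl z (by simp), by simp⟩

theorem exists_list_of_hasWalk {Z : Multiset G} {ℓ : ℕ} {g h : G}
    (hw : HasWalk (directedCayleyGraph Z) ℓ g h) :
    ∃ l : List G, l.length = ℓ ∧ (∀ z ∈ l, z ∈ Z) ∧ h = g * l.prod := by
  induction hw with
  | nil g => exact ⟨[], rfl, by simp, by simp⟩
  | snoc _ hadj ih =>
    obtain ⟨l, hl, hlZ, rfl⟩ := ih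
    obtain ⟨z, hz, rfl⟩ := hadj
    refine ⟨l ++ [z], by simp [hl], ?_, by simp [mul_assoc]⟩
    intro y hy
    rcases List.mem_append.1 hy with hy | hy
    · exact hlZ y hy
    · rw [List.mem_singleton.1 hy]
      exact hz

theorem mem_cayleyBall_of_list {Z : Multiset G} {R : ℝ≥0} (l : List G) (hl : ∀ z ∈ l, z ∈ Z)
    (hR : (l.length : ℝ≥0) ≤ R) : l.prod ∈ cayleyBall Z R := by
  have h1 : directedDist (directedCayleyGraph Z) 1 l.prod ≤ (l.length : ℕ∞) :=
    iInf₂_le l.length (hasWalk_of_list Z l hl)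
  have h2 : (directedDist (directedCayleyGraph Z) 1 l.prod : ℝ≥0∞) ≤ ((l.length : ℕ∞) : ℝ≥0∞) :=
    ENat.toENNReal_le.2 h1
  refine h2.trans ?_
  rw [ENat.toENNReal_coe]
  exact_mod_cast hR

theorem exists_list_of_mem_cayleyBall {Z : Multiset G} {R : ℝ≥0} {g : G} (hg : g ∈ cayleyBall Z R) :
    ∃ l : List G, l.length ≤ ⌊R⌋₊ ∧ (∀ z ∈ l, z ∈ Z) ∧ g = l.prod := by
  by_contra! hcon
  have h1 : ((⌊R⌋₊ + 1 : ℕ) : ℕ∞) ≤ directedDist (directedCayleyGraph Z) 1 g := by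
    refine le_iInf₂ fun ℓ hℓ => ?_
    obtain ⟨l, rfl, hlZ, hl⟩ := exists_list_of_hasWalk hℓ
    rw [one_mul] at hl
    have : ¬ l.length ≤ ⌊R⌋₊ := fun h => hcon l h hlZ hl
    exact_mod_cast Nat.succ_le_of_lt (not_le.1 this)
  have h2 : (((⌊R⌋₊ + 1 : ℕ) : ℕ∞) : ℝ≥0∞) ≤ (R : ℝ≥0∞) := (ENat.toENNReal_le.2 h1).trans hg
  rw [ENat.toENNReal_coe] at h2
  have h3 : ((⌊R⌋₊ + 1 : ℕ) : ℝ≥0) ≤ R := by exact_mod_cast h2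
  have := Nat.lt_floor_add_one R
  push_cast at h3
  exact absurd h3 this.not_ge

theorem typicalDistance_le {Z : Multiset G} {β : ℝ} {R : ℝ≥0}
    (h : β * (Nat.card G : ℝ) ≤ ((cayleyBall Z R).ncard : ℝ)) : typicalDistance Z β ≤ R := by
  unfold typicalDistance
  exact iInf₂_le R h

end Balls

/-! ### Application to the Heisenberg group: both bounds in finite form. -/

section Heisenberg

variable {p d k : ℕ}

theorem isUnitri_heisenberg (A : heisenbergGroup p d) :
    IsUnitri ((A : GL (Fin d) (ZMod p)) : Matrix (Fin d) (Fin d) (ZMod p)) := A.2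

variable [Fact p.Prime]

theorem IsUnitri.eq_unitriMat {F : Type*} [Field F] {A : Matrix (Fin d) (Fin d) F}
    (hA : IsUnitri A) : A = unitriMat fun x => A x.1.1 x.1.2 := by
  ext a b
  rcases lt_trichotomy a b with h | rfl | h
  · rw [unitriMat_of_lt _ h]
  · rw [hA.1, (isUnitri_unitriMat _).1]
  · rw [hA.2 a b h, (isUnitri_unitriMat _).2 a b h]

theorem IsUnitri.det {F : Type*} [Field F] {A : Matrix (Fin d) (Fin d) F} (hA : IsUnitri A) :
    A.det = 1 := by
  rw [Matrix.det_of_isUpperTriangular fun a b h => hA.2 a b h]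
  exact Finset.prod_eq_one fun i _ => hA.1 i

/-- An element of the Heisenberg group is given by its entries above the diagonal. -/
noncomputable def heisenbergEquiv (p d : ℕ) [Fact p.Prime] :
    heisenbergGroup p d ≃ (UpIdx d → ZMod p) where
  toFun A x := ((A : GL (Fin d) (ZMod p)) : Matrix (Fin d) (Fin d) (ZMod p)) x.1.1 x.1.2
  invFun x := ⟨Matrix.GeneralLinearGroup.mkOfDetNeZero (unitriMat x)
    (by rw [(isUnitri_unitriMat x).det]; exact one_ne_zero), isUnitri_unitriMat x⟩
  left_inv A := by
    refine Subtype.ext (Units.ext ?_)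
    exact (isUnitri_heisenberg A).eq_unitriMat.symm
  right_inv x := by
    funext y
    exact unitriMat_of_lt x y.2

theorem coe_heisenberg_eq_unitriMat (A : heisenbergGroup p d) :
    ((A : GL (Fin d) (ZMod p)) : Matrix (Fin d) (Fin d) (ZMod p)) =
      unitriMat (heisenbergEquiv p d A) := (isUnitri_heisenberg A).eq_unitriMat

noncomputable instance : Fintype (heisenbergGroup p d) :=
  Fintype.ofEquiv _ (heisenbergEquiv p d).symm

theorem card_heisenbergGroup : Fintype.card (heisenbergGroup p d) = p ^ (d * (d - 1) / 2) := by
  rw [Fintype.card_congr (heisenbergEquiv p d), Fintype.card_fun, ZMod.card, card_upIdx]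

/-- The entries of a family of elements of the Heisenberg group. -/
noncomputable def familyEquiv (p d k : ℕ) [Fact p.Prime] :
    (Fin k → heisenbergGroup p d) ≃ (UpIdx d → Fin k → ZMod p) :=
  (Equiv.arrowCongr (Equiv.refl _) (heisenbergEquiv p d)).trans (Equiv.piComm fun _ _ => ZMod p)

theorem familyEquiv_mem_wordSolutions (Z : Fin k → heisenbergGroup p d) (w w' : List (Fin k)) :
    familyEquiv p d k Z ∈ wordSolutions d (ZMod p) w w' ↔ (w.map Z).prod = (w'.map Z).prod := by
  have hcoe : ∀ w : List (Fin k), (((w.map Z).prod : heisenbergGroup p d) :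
      GL (Fin d) (ZMod p)).1 = (w.map (unitriFamily (familyEquiv p d k Z))).prod := by
    intro w
    induction w with
    | nil => simp
    | cons i w ih =>
      rw [List.map_cons, List.prod_cons, List.map_cons, List.prod_cons, ← ih, Subgroup.coe_mul,
        Units.val_mul, coe_heisenberg_eq_unitriMat (Z i)]
      rfl
  rw [wordSolutions, Finset.mem_filter, ← hcoe, ← hcoe]
  simp [Units.ext_iff, Subtype.ext_iff]

theorem card_filter_prod_eq (w w' : List (Fin k)) :
    (Finset.univ.filter fun Z : Fin k → heisenbergGroup p d =>
      (w.map Z).prod = (w'.map Z).prod).card = (wordSolutions d (ZMod p) w w').card := by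
  refine Finset.card_equiv (familyEquiv p d k) fun Z => ?_
  rw [familyEquiv_mem_wordSolutions]
  simp

/-- The typical distance of random generators is rarely larger than the length of the words of
the family. -/
theorem le_randomGeneratorsProb {s q K n R : ℕ} (hk : n + 1 + s * q ≤ k) (hK : K < p)
    (hqK : 0 < q * K) (hR : R < p) {β : ℝ} (hβ0 : 0 < β) (hβ1 : β < 1) :
    1 - (2 ^ d * (p : ℝ) ^ (d - 1) / ((k + R).choose R : ℝ) +
        2 ^ n * ((q * K : ℕ) : ℝ) ^ (s * d + d * n) * (p : ℝ) ^ (d * (d - 1) / 2) /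
          (((k + R).choose R : ℝ) * ((q * K : ℕ) : ℝ) ^ (s * n))) * (β / (1 - β)) ≤
      randomGeneratorsProb (heisenbergGroup p d) k fun Z =>
        typicalDistance Z β ≤ ((R + (n * (s * K) + n + 1) : ℕ) : ℝ≥0∞) := by
  classical
  set η : ℝ := 2 ^ d * (p : ℝ) ^ (d - 1) / ((k + R).choose R : ℝ) +
        2 ^ n * ((q * K : ℕ) : ℝ) ^ (s * d + d * n) * (p : ℝ) ^ (d * (d - 1) / 2) /
          (((k + R).choose R : ℝ) * ((q * K : ℕ) : ℝ) ^ (s * n)) with hη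
  -- The letters `0, …, n` serve as separators and the next `s * q` as slot letters, so separators
  -- are smaller. The `min` only makes `α` total.
  let α : ℕ → Fin k := fun m => ⟨min m (k - 1), by omega⟩
  have hβlt : ∀ (g : Fin s) (j : Fin q), n + 1 + (g * q + j) < k := by
    intro g j
    have h1 : (g + 1 : ℕ) * q ≤ s * q := Nat.mul_le_mul_right _ g.2
    rw [add_mul] at h1
    omega
  let b : Fin s → Fin q → Fin k := fun g j => ⟨n + 1 + (g * q + j), hβlt g j⟩
  have hα : ∀ i j, i ≤ n → j ≤ n → α i = α j → i = j := by
    intro i j hi hj h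
    have := Fin.ext_iff.1 h
    simp only [α] at this
    omega
  have hαβ : ∀ i, i ≤ n → ∀ g j, α i < b g j := by
    intro i hi g j
    rw [Fin.lt_def]
    simp only [α, b]
    omega
  have hb : ∀ g j g' j', b g j = b g' j' → g = g' ∧ j = j' := by
    intro g j g' j' h
    have h1 := Fin.ext_iff.1 h
    simp only [b, Nat.add_left_cancel_iff] at h1
    have hq : 0 < q := j.pos
    have h2 : (g : ℕ) = g' := by
      have := congrArg (· / q) h1
      simpa [mul_comm _ q, Nat.mul_add_div hq, Nat.div_eq_of_lt] using this
    refine ⟨Fin.ext h2, Fin.ext ?_⟩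
    rw [h2] at h1
    omega
  obtain ⟨𝒲, h𝒲card, h𝒲⟩ := exists_finset_multiset_card_le (Fin k) R
  rw [Fintype.card_fin] at h𝒲card
  have hN0 : 0 < (k + R).choose R := Nat.choose_pos (by omega)
  have key := sum_card_wordSolutions_le (p := p) (d := d) hα hαβ hb hK hqK hR 𝒲
    fun W hW => (h𝒲 W).1 hW
  set S := 𝒲 ×ˢ (Finset.univ : Finset (Fin n → Fin s → Fin q × Fin K)) with hS
  have hScard : S.card = (k + R).choose R * (q * K) ^ (s * n) := by
    rw [hS, Finset.card_product, Finset.card_univ, h𝒲card, Fintype.card_fun, Fintype.card_fun,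
      Fintype.card_prod, Fintype.card_fin, Fintype.card_fin, Fintype.card_fin, Fintype.card_fin,
      ← pow_mul]
  have hS0 : S.Nonempty := by
    rw [← Finset.card_pos, hScard]
    positivity
  let φ : (Fin k → heisenbergGroup p d) → (Multiset (Fin k) × (Fin n → Fin s → Fin q × Fin K)) →
    heisenbergGroup p d := fun Z ω => ((sortedBlockWord α b ω).map Z).prod
  have hΘ : Fintype.card (Fin k → heisenbergGroup p d) = (p ^ k) ^ (d * (d - 1) / 2) := by
    rw [Fintype.card_fun, card_heisenbergGroup, Fintype.card_fin, ← pow_mul, ← pow_mul, mul_comm]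
  have hsmall := card_small_image_le S hS0 φ (η := η) hβ0 hβ1 ?_
  · set bad := Finset.univ.filter fun Z => ((S.image (φ Z)).card : ℝ) <
      β * Fintype.card (heisenbergGroup p d) with hbad
    have hcompl : (Finset.univ \ bad : Finset (Fin k → heisenbergGroup p d)).card ≤
        {Z : Fin k → heisenbergGroup p d |
          typicalDistance (Multiset.map Z Finset.univ.val) β ≤
            ((R + (n * (s * K) + n + 1) : ℕ) : ℝ≥0∞)}.ncard := by
      rw [← Set.ncard_coe_finset]
      refine Set.ncard_le_ncard (fun Z hZ => ?_) (Set.toFinite _)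
      rw [Finset.mem_coe, Finset.mem_sdiff, hbad, Finset.mem_filter, not_and, not_lt] at hZ
      have hZ' := hZ.2 (Finset.mem_univ _)
      suffices h : β * (Nat.card (heisenbergGroup p d) : ℝ) ≤
          ((cayleyBall (Multiset.map Z Finset.univ.val)
            ((R + (n * (s * K) + n + 1) : ℕ) : ℝ≥0)).ncard : ℝ) by
        have h' : typicalDistance (Multiset.map Z Finset.univ.val) β ≤
            (((R + (n * (s * K) + n + 1) : ℕ) : ℝ≥0) : ℝ≥0∞) := typicalDistance_le h
        rwa [ENNReal.coe_natCast] at h'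
      rw [Nat.card_eq_fintype_card]
      refine hZ'.trans ?_
      rw [← Set.ncard_coe_finset]
      refine Nat.cast_le.2 (Set.ncard_le_ncard ?_ (Set.toFinite _))
      rw [Finset.coe_image]
      rintro _ ⟨ω, hω, rfl⟩
      refine mem_cayleyBall_of_list _ ?_ ?_
      · simp only [List.mem_map, Multiset.mem_map, forall_exists_index, and_imp]
        rintro z i _ rfl
        exact ⟨i, Finset.mem_univ_val i, rfl⟩
      · rw [List.length_map]
        refine Nat.cast_le.2 ((length_sortedBlockWord_le α b ω).trans ?_)
        exact Nat.add_le_add_right ((h𝒲 _).1 (Finset.mem_product.1 hω).1) _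
    rw [randomGeneratorsProb, Nat.card_eq_fintype_card, le_div_iff₀ (by
      exact_mod_cast Fintype.card_pos)]
    refine le_trans ?_ (Nat.cast_le.2 hcompl)
    have h1 := Finset.card_sdiff_add_card_eq_card (Finset.subset_univ bad)
    rw [Finset.card_univ] at h1
    have h2 : ((Finset.univ \ bad : Finset (Fin k → heisenbergGroup p d)).card : ℝ) + bad.card =
        Fintype.card (Fin k → heisenbergGroup p d) := by exact_mod_cast h1
    linarith
  · simp only [φ, card_filter_prod_eq]
    rw [card_heisenbergGroup, hΘ]
    rw [Fintype.card_fin, h𝒲card] at key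
    have key' : ((_ : ℕ) : ℝ) ≤ ((_ : ℕ) : ℝ) := Nat.cast_le.2 key
    rw [Nat.cast_mul] at key'
    refine key'.trans (le_of_eq ?_)
    rw [hScard, hη]
    have hN0' : ((k + R).choose R : ℝ) ≠ 0 := by exact_mod_cast hN0.ne'
    have hM0 : ((q * K : ℕ) : ℝ) ^ (s * n) ≠ 0 := pow_ne_zero _ (by exact_mod_cast hqK.ne')
    generalize hM : q * K = M at *
    push_cast
    field_simp
    ring

/-- The superdiagonal of an element of the Heisenberg group. -/
def superdiagonal (A : heisenbergGroup p d) (a : Fin d) : ZMod p :=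
  if h : (a : ℕ) + 1 < d then
    ((A : GL (Fin d) (ZMod p)) : Matrix (Fin d) (Fin d) (ZMod p)) a ⟨a + 1, h⟩ else 0

/-- Between `a` and `a + 1` there is no intermediate index, so only two terms of the product
survive. This homomorphism to an abelian group makes the order of the letters irrelevant for the
lower bound. -/
theorem superdiagonal_mul (A B : heisenbergGroup p d) :
    superdiagonal (A * B) = superdiagonal A + superdiagonal B := by
  funext a
  rw [Pi.add_apply]
  unfold superdiagonal
  split_ifs with h
  · have hlt : a < ⟨a + 1, h⟩ := Fin.lt_def.2 (Nat.lt_succ_self _)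
    rw [Subgroup.coe_mul, Units.val_mul, Matrix.mul_apply, Finset.sum_eq_add a ⟨a + 1, h⟩ hlt.ne,
      (isUnitri_heisenberg A).1, (isUnitri_heisenberg B).1, one_mul, mul_one, add_comm]
    · intro e _ he
      rcases lt_or_ge e a with h1 | h1
      · rw [(isUnitri_heisenberg A).2 a e h1, zero_mul]
      · have : (⟨a + 1, h⟩ : Fin d) < e := by
          rw [Fin.lt_def]
          have h2 : (e : ℕ) ≠ a := fun h => he.1 (Fin.ext h)
          have h3 : (e : ℕ) ≠ a + 1 := fun h => he.2 (Fin.ext h)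
          rw [Fin.le_def] at h1
          simp only
          omega
        rw [(isUnitri_heisenberg B).2 _ _ this, mul_zero]
    · simp
    · simp
  · rw [add_zero]

theorem superdiagonal_one : superdiagonal (1 : heisenbergGroup p d) = 0 := by
  have := superdiagonal_mul (1 : heisenbergGroup p d) 1
  rwa [mul_one, left_eq_add] at this

theorem card_filter_superdiagonal_mul_le (v : Fin d → ZMod p) :
    (Finset.univ.filter fun A : heisenbergGroup p d => superdiagonal A = v).card * p ^ (d - 1) ≤
      p ^ (d * (d - 1) / 2) := by
  classical
  have hcard := Fintype.card_subtype_compl fun x : UpIdx d => (x.1.1 : ℕ) + 1 = x.1.2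
  have hsup : d - 1 ≤ Fintype.card {x : UpIdx d // (x.1.1 : ℕ) + 1 = x.1.2} := by
    have hinj : Function.Injective fun i : Fin (d - 1) =>
        (⟨⟨(⟨i, by omega⟩, ⟨i + 1, by omega⟩), Fin.lt_def.2 (Nat.lt_succ_self _)⟩, rfl⟩ :
          {x : UpIdx d // (x.1.1 : ℕ) + 1 = x.1.2}) := by
      intro i j hij
      simp only [Subtype.mk.injEq, Prod.mk.injEq, Fin.mk.injEq] at hij
      exact Fin.ext hij.1
    simpa using Fintype.card_le_of_injective _ hinj
  have hle := Fintype.card_subtype_le fun x : UpIdx d => (x.1.1 : ℕ) + 1 = x.1.2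
  rw [card_upIdx] at hcard hle
  have hfib : (Finset.univ.filter fun A : heisenbergGroup p d => superdiagonal A = v).card ≤
      p ^ Fintype.card {x : UpIdx d // ¬ (x.1.1 : ℕ) + 1 = x.1.2} := by
    have : p ^ Fintype.card {x : UpIdx d // ¬ (x.1.1 : ℕ) + 1 = x.1.2} = (Finset.univ :
        Finset ({x : UpIdx d // ¬ (x.1.1 : ℕ) + 1 = x.1.2} → ZMod p)).card := by
      rw [Finset.card_univ, Fintype.card_fun, ZMod.card]
    rw [this]
    refine Finset.card_le_card_of_injOn (fun A x => heisenbergEquiv p d A x.1) (by simp) ?_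
    intro A hA B hB hAB
    simp only [Finset.coe_filter, Finset.mem_univ, true_and, Set.mem_ofPred_eq] at hA hB
    refine (heisenbergEquiv p d).injective (funext fun x => ?_)
    by_cases hx : (x.1.1 : ℕ) + 1 = x.1.2
    · have h1 := congrFun (hA.trans hB.symm) x.1.1
      have h2 : (x.1.1 : ℕ) + 1 < d := hx ▸ x.1.2.2
      have h3 : x.1.2 = ⟨x.1.1 + 1, h2⟩ := Fin.ext hx.symm
      simp only [superdiagonal, h2, dif_pos] at h1
      simp only [heisenbergEquiv, Equiv.coe_fn_mk]
      rw [h3]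
      exact h1
    · exact congrFun hAB ⟨x, hx⟩
  refine (Nat.mul_le_mul_right _ hfib).trans ?_
  rw [← pow_add]
  exact Nat.pow_le_pow_right (Fact.out : p.Prime).pos (by omega)

/-- A ball is not larger than the preimage of a ball of the abelianization. -/
theorem le_choose_of_le_ncard_cayleyBall (Z : Multiset (heisenbergGroup p d)) {β : ℝ} {R : ℝ≥0}
    (h : β * (Nat.card (heisenbergGroup p d) : ℝ) ≤ ((cayleyBall Z R).ncard : ℝ)) :
    β * (p : ℝ) ^ (d - 1) ≤ ((Multiset.card Z + ⌊R⌋₊).choose ⌊R⌋₊ : ℝ) := by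
  classical
  obtain ⟨𝒲, h𝒲card, h𝒲⟩ := exists_finset_multiset_card_le (Fin Z.card) ⌊R⌋₊
  rw [Fintype.card_fin] at h𝒲card
  have hp0 : 0 < p := (Fact.out : p.Prime).pos
  have hlen : Z.toList.length = Z.card := Multiset.length_toList Z
  let z : Fin Z.card → heisenbergGroup p d := fun i => Z.toList[i]
  -- `f W` is the superdiagonal shared by all words whose multiset of letters is `W`.
  let f : Multiset (Fin Z.card) → Fin d → ZMod p := fun W => (W.map fun i => superdiagonal (z i)).sum
  have hball : cayleyBall Z R ⊆
      ((𝒲.biUnion fun W => Finset.univ.filter fun A => superdiagonal A = f W : Finset _) :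
        Set (heisenbergGroup p d)) := by
    intro g hg
    obtain ⟨l, hl, hlZ, rfl⟩ := exists_list_of_mem_cayleyBall hg
    have : ∃ w : List (Fin Z.card), l = w.map z := by
      clear hg hl
      induction l with
      | nil => exact ⟨[], rfl⟩
      | cons a l ih =>
        obtain ⟨w, hw⟩ := ih fun y hy => hlZ y (List.mem_cons_of_mem _ hy)
        obtain ⟨i, hi, hia⟩ := List.mem_iff_getElem.1
          (Multiset.mem_toList.2 (hlZ a List.mem_cons_self))
        exact ⟨⟨i, hlen ▸ hi⟩ :: w, by rw [List.map_cons, ← hw, ← hia]; rfl⟩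
    obtain ⟨w, rfl⟩ := this
    rw [List.length_map] at hl
    simp only [Finset.coe_biUnion, Set.mem_iUnion, Finset.mem_coe, Finset.mem_filter,
      Finset.mem_univ, true_and]
    refine ⟨w, (h𝒲 _).2 hl, ?_⟩
    clear hg hl hlZ
    induction w with
    | nil => simp [f, superdiagonal_one]
    | cons i w ih =>
      rw [List.map_cons, List.prod_cons, superdiagonal_mul, ih]
      simp [f]
  have h1 : (cayleyBall Z R).ncard * p ^ (d - 1) ≤ 𝒲.card * p ^ (d * (d - 1) / 2) := by
    refine (Nat.mul_le_mul_right _ (Set.ncard_le_ncard hball (Set.toFinite _))).trans ?_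
    rw [Set.ncard_coe_finset]
    refine (Nat.mul_le_mul_right _ Finset.card_biUnion_le).trans ?_
    rw [Finset.sum_mul]
    exact Finset.sum_le_card_nsmul _ _ _ fun W _ => card_filter_superdiagonal_mul_le (f W)
  rw [Nat.card_eq_fintype_card, card_heisenbergGroup] at h
  rw [h𝒲card] at h1
  have h2 : ((cayleyBall Z R).ncard : ℝ) * (p : ℝ) ^ (d - 1) ≤
      ((Multiset.card Z + ⌊R⌋₊).choose ⌊R⌋₊ : ℝ) * (p : ℝ) ^ (d * (d - 1) / 2) := by
    exact_mod_cast h1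
  have hp0' : (0 : ℝ) < p := by exact_mod_cast hp0
  refine le_of_mul_le_mul_right ?_ (pow_pos hp0' (d * (d - 1) / 2))
  calc β * (p : ℝ) ^ (d - 1) * (p : ℝ) ^ (d * (d - 1) / 2)
      = β * ((p ^ (d * (d - 1) / 2) : ℕ) : ℝ) * (p : ℝ) ^ (d - 1) := by push_cast; ring
    _ ≤ ((cayleyBall Z R).ncard : ℝ) * (p : ℝ) ^ (d - 1) :=
      mul_le_mul_of_nonneg_right h (by positivity)
    _ ≤ _ := h2

end Heisenberg

/-! ### Stirling-type estimates and the choice of parameters. -/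

section Estimates

/-- The induction step is `e ≤ (1 + 1 / k) ^ (k + 1)`. The loss of a factor of order `k` over
Stirling's formula is harmless against the exponential gain `(1 + ε / 2) ^ k`. -/
theorem factorial_mul_exp_pow_le {k : ℕ} (hk : 1 ≤ k) :
    (k.factorial : ℝ) * Real.exp 1 ^ k ≤ Real.exp 1 * (k : ℝ) ^ (k + 1) := by
  induction k, hk using Nat.le_induction with
  | base => simp
  | succ k hk ih =>
    have hk0 : (0 : ℝ) < k := by exact_mod_cast hk
    have hk1 : (0 : ℝ) < k + 1 := by linarith
    have h1 : Real.exp 1 * (k : ℝ) ^ (k + 1) ≤ ((k : ℝ) + 1) ^ (k + 1) := by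
      have h2 : 1 / ((k : ℝ) + 1) ≤ Real.log ((k + 1) / k) := by
        have := Real.one_sub_inv_le_log_of_pos (show 0 < ((k : ℝ) + 1) / k by positivity)
        refine le_trans (le_of_eq ?_) this
        field_simp
        ring
      have h3 : Real.exp 1 ≤ (((k : ℝ) + 1) / k) ^ (k + 1) := by
        rw [← Real.exp_log (show 0 < (((k : ℝ) + 1) / k) ^ (k + 1) by positivity), Real.log_pow]
        refine Real.exp_le_exp.2 ?_
        push_cast
        calc (1 : ℝ) = (k + 1) * (1 / (k + 1)) := by field_simp
          _ ≤ _ := mul_le_mul_of_nonneg_left h2 hk1.le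
      rwa [div_pow, le_div_iff₀ (by positivity)] at h3
    have he := Real.exp_pos 1
    rw [Nat.factorial_succ]
    push_cast
    calc ((k : ℝ) + 1) * k.factorial * Real.exp 1 ^ (k + 1)
        = (k.factorial * Real.exp 1 ^ k) * ((k + 1) * Real.exp 1) := by ring
      _ ≤ (Real.exp 1 * (k : ℝ) ^ (k + 1)) * ((k + 1) * Real.exp 1) :=
        mul_le_mul_of_nonneg_right ih (by positivity)
      _ ≤ ((k : ℝ) + 1) ^ (k + 1) * ((k + 1) * Real.exp 1) :=
        mul_le_mul_of_nonneg_right h1 (by positivity)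
      _ = _ := by ring

theorem choose_mul_pow_le (k m : ℕ) :
    ((k + m).choose m : ℝ) * (k : ℝ) ^ k ≤ (Real.exp 1 * (k + m)) ^ k := by
  have h1 : ((k + m).choose m : ℝ) ≤ ((k + m : ℕ) : ℝ) ^ k / k.factorial := by
    rw [← Nat.choose_symm_add]
    exact Nat.choose_le_pow_div k (k + m)
  have h2 : (k : ℝ) ^ k / k.factorial ≤ Real.exp 1 ^ k := by
    rw [← Real.exp_nat_mul, mul_one]
    exact Real.pow_div_factorial_le_exp _ (Nat.cast_nonneg k) k
  calc ((k + m).choose m : ℝ) * (k : ℝ) ^ k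
      ≤ ((k + m : ℕ) : ℝ) ^ k / k.factorial * (k : ℝ) ^ k :=
        mul_le_mul_of_nonneg_right h1 (by positivity)
    _ = ((k + m : ℕ) : ℝ) ^ k * ((k : ℝ) ^ k / k.factorial) := by ring
    _ ≤ ((k + m : ℕ) : ℝ) ^ k * Real.exp 1 ^ k := mul_le_mul_of_nonneg_left h2 (by positivity)
    _ = _ := by rw [mul_pow, Nat.cast_add, mul_comm]

theorem pow_le_choose_mul {k : ℕ} (hk : 1 ≤ k) (m : ℕ) :
    (Real.exp 1 * (m + 1)) ^ k ≤
      ((k + m).choose m : ℝ) * (Real.exp 1 * (k : ℝ) ^ (k + 1)) := by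
  have h1 : (m + 1) ^ k ≤ k.factorial * (k + m).choose m := by
    have := Nat.pow_sub_le_descFactorial (k + m) k
    rwa [show k + m + 1 - k = m + 1 by omega, Nat.descFactorial_eq_factorial_mul_choose,
      Nat.choose_symm_add] at this
  have h2 : ((m : ℝ) + 1) ^ k ≤ k.factorial * ((k + m).choose m : ℝ) := by exact_mod_cast h1
  calc (Real.exp 1 * (m + 1)) ^ k = (m + 1 : ℝ) ^ k * Real.exp 1 ^ k := by
        rw [mul_pow, mul_comm]
    _ ≤ k.factorial * ((k + m).choose m : ℝ) * Real.exp 1 ^ k :=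
      mul_le_mul_of_nonneg_right h2 (by positivity)
    _ = ((k + m).choose m : ℝ) * (k.factorial * Real.exp 1 ^ k) := by ring
    _ ≤ _ := mul_le_mul_of_nonneg_left (factorial_mul_exp_pow_le hk) (by positivity)

theorem randomGeneratorsProb_mono {G : Type*} [Finite G] {k : ℕ} {E E' : Multiset G → Prop}
    (h : ∀ Z, Multiset.card Z = k → E Z → E' Z) :
    randomGeneratorsProb G k E ≤ randomGeneratorsProb G k E' := by
  unfold randomGeneratorsProb
  refine div_le_div_of_nonneg_right (Nat.cast_le.2 ?_) (Nat.cast_nonneg _)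
  exact Set.ncard_le_ncard (fun Z hZ => h _ (by simp) hZ) (Set.toFinite _)

theorem randomGeneratorsProb_le_one {G : Type*} [Finite G] {k : ℕ} {E : Multiset G → Prop} :
    randomGeneratorsProb G k E ≤ 1 := by
  unfold randomGeneratorsProb
  refine div_le_one_of_le₀ (Nat.cast_le.2 ?_) (Nat.cast_nonneg _)
  rw [← Set.ncard_univ]
  exact Set.ncard_le_ncard (Set.subset_univ _) (Set.toFinite _)

/-- The families of small rank are negligible. -/
theorem two_pow_mul_pow_le {p d k n : ℕ} {x M : ℝ} (hd : 3 ≤ d) (hn : n = k / 3) (hx1 : 1 ≤ x)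
    (hxk : x ^ k = (p : ℝ) ^ (d - 1)) (hkd : 16 * d ≤ k) (hM : 2 * x ≤ M) :
    2 ^ n * M ^ (4 * d * d + d * n) * (p : ℝ) ^ (d * (d - 1) / 2) ≤
      (p : ℝ) ^ (d - 1) * M ^ (4 * d * n) := by
  obtain ⟨e, rfl⟩ : ∃ e, d = e + 2 := ⟨d - 2, by omega⟩
  obtain ⟨J, hJ⟩ : ∃ J, (e + 1) * e = 2 * J :=
    ⟨(e + 1) * e / 2, (Nat.mul_div_cancel' (by
      rw [mul_comm]; exact (Nat.even_mul_succ_self e).two_dvd)).symm⟩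
  have hexp : (e + 2) * (e + 2 - 1) / 2 = J + (e + 2 - 1) := by
    have : (e + 2) * (e + 2 - 1) = 2 * (J + (e + 2 - 1)) := by
      rw [show e + 2 - 1 = e + 1 by omega, mul_add 2, ← hJ]
      ring
    omega
  have hM1 : 1 ≤ M := by linarith
  -- After squaring, `p ^ ((d - 1) * (d - 2))` becomes the integral power `x ^ (k * (d - 2))`, with
  -- no halved exponent.
  have hsq : (2 ^ n * M ^ (4 * (e + 2) * (e + 2) + (e + 2) * n) * (p : ℝ) ^ J) ^ 2 ≤
      (M ^ (4 * (e + 2) * n)) ^ 2 := by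
    have h1 : ((p : ℝ) ^ J) ^ 2 = x ^ (k * e) := by
      rw [← pow_mul, mul_comm J, ← hJ, pow_mul x, hxk, ← pow_mul]
      congr 1
    have h2 : (2 : ℝ) ^ (n * 2) ≤ 2 ^ (k * (e + 2)) := by
      refine pow_le_pow_right₀ (by norm_num) ?_
      have : n * 2 ≤ k := by omega
      exact this.trans (Nat.le_mul_of_pos_right _ (by omega))
    have h3 : x ^ (k * e) ≤ x ^ (k * (e + 2)) :=
      pow_le_pow_right₀ hx1 (Nat.mul_le_mul_left _ (by omega))
    calc (2 ^ n * M ^ (4 * (e + 2) * (e + 2) + (e + 2) * n) * (p : ℝ) ^ J) ^ 2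
        = 2 ^ (n * 2) * M ^ ((4 * (e + 2) * (e + 2) + (e + 2) * n) * 2) * x ^ (k * e) := by
          rw [mul_pow, mul_pow, h1, ← pow_mul, ← pow_mul]
      _ ≤ 2 ^ (k * (e + 2)) * M ^ ((4 * (e + 2) * (e + 2) + (e + 2) * n) * 2) *
          x ^ (k * (e + 2)) := by gcongr
      _ = (2 * x) ^ (k * (e + 2)) * M ^ ((4 * (e + 2) * (e + 2) + (e + 2) * n) * 2) := by
          rw [mul_pow 2 x]
          ring
      _ ≤ M ^ (k * (e + 2)) * M ^ ((4 * (e + 2) * (e + 2) + (e + 2) * n) * 2) := by gcongr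
      _ = M ^ (k * (e + 2) + (4 * (e + 2) * (e + 2) + (e + 2) * n) * 2) := (pow_add _ _ _).symm
      _ ≤ M ^ (4 * (e + 2) * n * 2) := by
        -- After division by `2 * d` the exponents compare through `k + 8 * d ≤ 6 * n`, which holds
        -- because `n` is about `k / 3` and `16 * d ≤ k`.
        refine pow_le_pow_right₀ hM1 ?_
        have h4 : k + 8 * (e + 2) ≤ 6 * n := by omega
        have h5 := Nat.mul_le_mul_left (e + 2) h4
        nlinarith
      _ = _ := pow_mul _ _ _
  have hle := (pow_le_pow_iff_left₀ (by positivity) (by positivity) two_ne_zero).1 hsq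
  rw [hexp, pow_add]
  calc _ = (p : ℝ) ^ (e + 2 - 1) *
        (2 ^ n * M ^ (4 * (e + 2) * (e + 2) + (e + 2) * n) * (p : ℝ) ^ J) := by ring
    _ ≤ _ := mul_le_mul_of_nonneg_left hle (by positivity)

/-- The typical distance is almost surely at most `(1 + ε) M*`, with an explicit error. -/
theorem le_randomGeneratorsProb_typicalRadius {p d k : ℕ} [Fact p.Prime] {x ε δ β : ℝ}
    (hε : 0 < ε) (hδ : δ = ε / (8 * Real.exp 1)) (hβ0 : 0 < β) (hβ1 : β < 1) (hd : 3 ≤ d)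
    (hx1 : 1 ≤ x) (hxk : x ^ k = (p : ℝ) ^ (d - 1)) (hkd : 16 * d ≤ k)
    (hkd2 : 64 * (d : ℝ) ^ 2 ≤ δ * k) (hdx : 2 * d ≤ δ * x) (hex : 4 * Real.exp 1 ≤ ε * x)
    (hp : (1 + ε) * k * x < p) :
    1 - Real.exp 1 * k * (2 ^ d + 1) / (1 + ε / 2) ^ k * (β / (1 - β)) ≤
      randomGeneratorsProb (heisenbergGroup p d) k fun Z =>
        typicalDistance Z β ≤ ENNReal.ofReal ((1 + ε) * (k * x / Real.exp 1)) := by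
  have he := Real.exp_pos 1
  have he1 : 1 ≤ Real.exp 1 := Real.one_le_exp zero_le_one
  have hδ0 : 0 < δ := by rw [hδ]; positivity
  have hd0 : (0 : ℝ) < d := by exact_mod_cast (show 0 < d by omega)
  have hk0 : (0 : ℝ) < k := by exact_mod_cast (show 0 < k by omega)
  have hk1 : (1 : ℝ) ≤ k := by exact_mod_cast (show 1 ≤ k by omega)
  have hx0 : 0 < x := by linarith
  have hp0 : (0 : ℝ) < p := by exact_mod_cast (Fact.out : p.Prime).pos
  -- The separators take about `k / 3` letters and the `4 * d` groups of `q` letters at most `k /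
  -- 2`, so they fit into `k`. `K` is small enough to keep the block words within `ε / 2 * M*`, yet
  -- `q * K ≥ 2 * x`.
  set n := k / 3 with hn
  set q := k / (8 * d) with hq
  set K := ⌊δ * x / d⌋₊ with hK
  -- Half of the margin `ε` makes the multisets outnumber `p ^ (d - 1)` exponentially; the other
  -- half pays for the block words.
  set r := (1 + ε / 2) * (k * x / Real.exp 1) with hr
  have hr0 : 0 ≤ r := by positivity
  set R := ⌊r⌋₊ with hR
  have hkx : k * x / Real.exp 1 ≤ k * x := div_le_self (by positivity) he1
  have hδx : δ * x ≤ ε * x := by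
    rw [hδ]
    refine mul_le_mul_of_nonneg_right (div_le_self hε.le (by linarith)) hx0.le
  have hKle : (K : ℝ) ≤ δ * x / d := Nat.floor_le (by positivity)
  have hKp : K < p := by
    have h1 : δ * x / d ≤ δ * x := div_le_self (by positivity) (by
      exact_mod_cast (show 1 ≤ d by omega))
    have h2 : ε * x ≤ (1 + ε) * k * x := by
      refine mul_le_mul_of_nonneg_right ?_ hx0.le
      nlinarith
    exact_mod_cast (show (K : ℝ) < p by linarith)
  have hRp : R < p := by
    have h1 : (R : ℝ) ≤ r := Nat.floor_le hr0
    have h2 : r ≤ (1 + ε) * (k * x) :=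
      mul_le_mul (by linarith) hkx (by positivity) (by linarith)
    exact_mod_cast (show (R : ℝ) < p by linarith)
  have hqge : (k : ℝ) / (16 * d) ≤ q := by
    have h1 : (k : ℝ) / (8 * d) < q + 1 := by
      have := Nat.lt_floor_add_one ((k : ℝ) / ((8 * d : ℕ) : ℝ))
      rw [Nat.floor_div_eq_div] at this
      push_cast at this
      exact this
    have h2 : 1 ≤ (k : ℝ) / (16 * d) := by
      rw [one_le_div (by positivity)]
      exact_mod_cast hkd
    have h3 : (k : ℝ) / (8 * d) = 2 * (k / (16 * d)) := by
      field_simp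
      norm_num
    linarith
  have hKge : δ * x / (2 * d) ≤ K := by
    have h1 : δ * x / d < K + 1 := Nat.lt_floor_add_one _
    have h2 : 1 ≤ δ * x / (2 * d) := by rwa [one_le_div (by positivity)]
    have h3 : δ * x / d = 2 * (δ * x / (2 * d)) := by field_simp
    linarith
  have hM : 2 * x ≤ ((q * K : ℕ) : ℝ) := by
    push_cast
    refine le_trans ?_ (mul_le_mul hqge hKge (by positivity) (by positivity))
    rw [div_mul_div_comm, le_div_iff₀ (by positivity)]
    nlinarith [mul_le_mul_of_nonneg_right hkd2 hx0.le]
  have hqK : 0 < q * K := by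
    have : (0 : ℝ) < ((q * K : ℕ) : ℝ) := by linarith
    exact_mod_cast this
  have hfit : n + 1 + 4 * d * q ≤ k := by
    have h1 : 8 * d * q ≤ k := Nat.mul_div_le k (8 * d)
    have h2 : 3 * n ≤ k := Nat.mul_div_le k 3
    have h3 : 8 * d * q = 2 * (4 * d * q) := by ring
    omega
  have key := le_randomGeneratorsProb (p := p) (d := d) hfit hKp hqK hRp hβ0 hβ1
  set M : ℝ := ((q * K : ℕ) : ℝ) with hMdef
  set C : ℝ := ((k + R).choose R : ℝ) with hC
  have hC0 : 0 < C := by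
    rw [hC]
    exact_mod_cast Nat.choose_pos (by omega)
  have hCge : ((1 + ε / 2) * x) ^ k ≤ C * (Real.exp 1 * k) := by
    have h1 := pow_le_choose_mul (show 1 ≤ k by omega) R
    have h2 : (1 + ε / 2) * x * k ≤ Real.exp 1 * (R + 1) := by
      have : r ≤ R + 1 := (Nat.lt_floor_add_one r).le
      calc (1 + ε / 2) * x * k = Real.exp 1 * r := by rw [hr]; field_simp
        _ ≤ _ := mul_le_mul_of_nonneg_left this he.le
    have h3 := (pow_le_pow_left₀ (by positivity) h2 k).trans h1
    rw [mul_pow _ (k : ℝ)] at h3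
    refine le_of_mul_le_mul_right (h3.trans_eq ?_) (pow_pos hk0 k)
    ring
  have hpow := two_pow_mul_pow_le (p := p) hd hn hx1 hxk hkd hM
  have hM0 : 0 < M := by linarith
  have hη : 2 ^ d * (p : ℝ) ^ (d - 1) / C + 2 ^ n * M ^ (4 * d * d + d * n) *
      (p : ℝ) ^ (d * (d - 1) / 2) / (C * M ^ (4 * d * n)) ≤
      Real.exp 1 * k * (2 ^ d + 1) / (1 + ε / 2) ^ k := by
    calc _ ≤ 2 ^ d * (p : ℝ) ^ (d - 1) / C +
          (p : ℝ) ^ (d - 1) * M ^ (4 * d * n) / (C * M ^ (4 * d * n)) := by gcongr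
      _ = (2 ^ d + 1) * x ^ k / C := by
        rw [hxk]
        field_simp
      _ ≤ _ := by
        rw [div_le_div_iff₀ hC0 (by positivity)]
        rw [mul_pow] at hCge
        calc (2 ^ d + 1) * x ^ k * (1 + ε / 2) ^ k = (2 ^ d + 1) * ((1 + ε / 2) ^ k * x ^ k) := by
              ring
          _ ≤ (2 ^ d + 1) * (C * (Real.exp 1 * k)) :=
            mul_le_mul_of_nonneg_left hCge (by positivity)
          _ = _ := by ring
  have hβ : 0 ≤ β / (1 - β) := (div_pos hβ0 (by linarith)).le
  refine le_trans ?_ (key.trans (randomGeneratorsProb_mono fun Z _ hZ => hZ.trans ?_))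
  · have := mul_le_mul_of_nonneg_right hη hβ
    linarith
  · rw [← ENNReal.ofReal_natCast]
    refine ENNReal.ofReal_le_ofReal ?_
    have h1 : (R : ℝ) ≤ r := Nat.floor_le hr0
    have h2 : (n : ℝ) ≤ k / 3 := by
      have := Nat.cast_div_le (α := ℝ) (m := k) (n := 3)
      exact_mod_cast this
    have h3 : (d : ℝ) * K ≤ δ * x := by
      rw [mul_comm]
      exact (le_div_iff₀ hd0).1 hKle
    have h4 : (n : ℝ) * (4 * d * K) ≤ k / 3 * (4 * (δ * x)) := by
      refine mul_le_mul h2 ?_ (by positivity) (by positivity)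
      linarith
    have h5 : (n : ℝ) + 1 ≤ k := by
      have : n + 1 ≤ k := by omega
      exact_mod_cast this
    have h6 : k / 3 * (4 * (δ * x)) = k * x / Real.exp 1 * (ε / 6) := by
      rw [hδ]
      field_simp
      ring
    have h7 : (k : ℝ) ≤ k * x / Real.exp 1 * (ε / 4) := by
      have : (k : ℝ) * (4 * Real.exp 1) ≤ k * (ε * x) := mul_le_mul_of_nonneg_left hex hk0.le
      rw [div_mul_div_comm, le_div_iff₀ (by positivity)]
      linarith
    have h8 : 0 < k * x / Real.exp 1 := by positivity
    push_cast
    have h9 : k * x / Real.exp 1 * (ε / 6) + k * x / Real.exp 1 * (ε / 4) ≤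
        k * x / Real.exp 1 * (ε / 2) := by
      have := mul_pos h8 hε
      linarith
    rw [hr] at h1
    linarith

/-- The typical distance of any `k` generators is at least `(1 - ξ) M*`. -/
theorem le_typicalDistance {p d k : ℕ} [Fact p.Prime] {x ξ β : ℝ} (hξ0 : 0 < ξ) (hξ1 : ξ < 1)
    (hk : 1 ≤ k) (hx1 : 1 ≤ x) (hxk : x ^ k = (p : ℝ) ^ (d - 1)) (hex : 2 * Real.exp 1 ≤ ξ * x)
    (hβ : (1 - ξ / 2) ^ k < β) (Z : Multiset (heisenbergGroup p d)) (hZ : Multiset.card Z = k) :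
    ENNReal.ofReal (k * x / Real.exp 1 * (1 - ξ)) ≤ typicalDistance Z β := by
  have he := Real.exp_pos 1
  have hk0 : (0 : ℝ) < k := by exact_mod_cast hk
  have hx0 : 0 < x := by linarith
  refine le_iInf₂ fun R hR => ?_
  by_contra hlt
  rw [not_le] at hlt
  have h1 := le_choose_of_le_ncard_cayleyBall Z hR
  rw [hZ, ← hxk] at h1
  have hR' : (R : ℝ) < k * x / Real.exp 1 * (1 - ξ) := by
    rw [← ENNReal.ofReal_coe_nnreal] at hlt
    exact (ENNReal.ofReal_lt_ofReal_iff_of_nonneg R.2).1 hlt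
  have h2 : (⌊R⌋₊ : ℝ) ≤ R := by exact_mod_cast Nat.floor_le R.2
  have h3 := choose_mul_pow_le k ⌊R⌋₊
  -- The summand `Real.exp 1 * k` is absorbed by half of the margin, as `2 * Real.exp 1 ≤ ξ * x`.
  have h4 : Real.exp 1 * (k + ⌊R⌋₊) ≤ k * ((1 - ξ / 2) * x) := by
    have h5 : Real.exp 1 * (⌊R⌋₊ : ℝ) ≤ k * x * (1 - ξ) := by
      calc Real.exp 1 * (⌊R⌋₊ : ℝ) ≤ Real.exp 1 * (k * x / Real.exp 1 * (1 - ξ)) :=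
            mul_le_mul_of_nonneg_left (by linarith) he.le
        _ = _ := by field_simp
    have h6 := mul_le_mul_of_nonneg_left hex hk0.le
    linarith
  have h5 := h3.trans (pow_le_pow_left₀ (by positivity) h4 k)
  rw [mul_pow, mul_pow, mul_comm] at h5
  have h6 := le_of_mul_le_mul_left h5 (pow_pos hk0 k)
  have h7 := le_of_mul_le_mul_right (h1.trans h6) (pow_pos hx0 k)
  linarith

end Estimates

/-! ### The size conditions hold for large `N`. -/

section Asymptotic

variable {k p d : ℕ → ℕ}

theorem pow_rpow_div_eq {k p d : ℕ} (hk : 1 ≤ k) (hd : 1 ≤ d) :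
    ((p : ℝ) ^ (((d : ℝ) - 1) / (k : ℝ))) ^ k = (p : ℝ) ^ (d - 1) := by
  have hk0 : (k : ℝ) ≠ 0 := by exact_mod_cast (show k ≠ 0 by omega)
  rw [← Real.rpow_natCast, ← Real.rpow_mul (Nat.cast_nonneg p), div_mul_cancel₀ _ hk0,
    ← Real.rpow_natCast, Nat.cast_sub hd, Nat.cast_one]

theorem one_le_rpow_div {k p d : ℕ} (hp : p.Prime) (hd : 1 ≤ d) :
    1 ≤ (p : ℝ) ^ (((d : ℝ) - 1) / (k : ℝ)) := by
  refine Real.one_le_rpow (by exact_mod_cast hp.one_le) (div_nonneg ?_ (Nat.cast_nonneg k))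
  have : (1 : ℝ) ≤ d := by exact_mod_cast hd
  linarith

theorem tendsto_rpow_div_atTop (hp : ∀ N, (p N).Prime) (hd : ∀ N, 3 ≤ d N)
    (hk : Tendsto k atTop atTop)
    (hkd : (fun N => (k N : ℝ)) =o[atTop] fun N => (d N : ℝ) * Real.log (p N)) :
    Tendsto (fun N => (p N : ℝ) ^ (((d N : ℝ) - 1) / (k N : ℝ))) atTop atTop := by
  have hlog : Tendsto (fun N => Real.log (p N) * (((d N : ℝ) - 1) / (k N : ℝ))) atTop atTop := by
    refine tendsto_atTop.2 fun b => ?_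
    -- The factor `2` covers the passage from `d` to `d - 1`, since `d - 1 ≥ d / 2`.
    have hc : 0 < 1 / (2 * (|b| + 1)) := by positivity
    filter_upwards [hkd.def hc, hk.eventually_ge_atTop 1] with N h1 h2
    have hk0 : (0 : ℝ) < k N := by exact_mod_cast h2
    have hd3 : (3 : ℝ) ≤ d N := by exact_mod_cast hd N
    have hl : 0 ≤ Real.log (p N) := Real.log_nonneg (by exact_mod_cast (hp N).one_le)
    rw [Real.norm_of_nonneg hk0.le, Real.norm_of_nonneg (by positivity), one_div_mul_eq_div,
      le_div_iff₀ (by positivity)] at h1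
    have hb := le_abs_self b
    rw [← mul_div_assoc, le_div_iff₀ hk0]
    nlinarith
  refine (Real.tendsto_exp_atTop.comp hlog).congr fun N => ?_
  rw [Function.comp, Real.rpow_def_of_pos (by exact_mod_cast (hp N).pos)]

/-- Needed so that multiplicities stay below `p` and are determined by their residues. With `y = p ^
(1 / 8)` one has `x ≤ y` and `k ≤ d * log p ≤ 4 * y ^ 3`, so `k * x` is at most `4 * y ^ 4`, far
below `p = y ^ 8`. -/
theorem eventually_mul_lt_prime (hp : ∀ N, (p N).Prime) (hd : ∀ N, 3 ≤ d N)
    (hk : Tendsto k atTop atTop)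
    (hkd : (fun N => (k N : ℝ)) =o[atTop] fun N => (d N : ℝ) * Real.log (p N))
    (hdk : ∀ᶠ N in atTop, 16 * d N ≤ k N)
    (hdx : (fun N => (d N : ℝ)) =o[atTop] (fun N => (p N : ℝ) ^ (((d N : ℝ) - 1) / (k N : ℝ))))
    {c : ℝ} (hc : 0 < c) :
    ∀ᶠ N in atTop, c * k N * (p N : ℝ) ^ (((d N : ℝ) - 1) / (k N : ℝ)) < p N := by
  have hx := tendsto_rpow_div_atTop hp hd hk hkd
  filter_upwards [hkd.def one_pos, hk.eventually_ge_atTop 1, hdk, hdx.def one_pos,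
    hx.eventually_gt_atTop (4 * c)] with N h1 h2 h3 h4 h5
  set x : ℝ := (p N : ℝ) ^ (((d N : ℝ) - 1) / (k N : ℝ)) with hxdef
  have hp1 : (1 : ℝ) ≤ p N := by exact_mod_cast (hp N).one_le
  have hp0 : (0 : ℝ) < p N := by linarith
  have hk0 : (0 : ℝ) < k N := by exact_mod_cast h2
  have hd0 : (0 : ℝ) ≤ d N := Nat.cast_nonneg _
  have hx1 : 1 ≤ x := one_le_rpow_div (hp N) (by have := hd N; omega)
  have hl : 0 ≤ Real.log (p N) := Real.log_nonneg hp1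
  rw [one_mul, Real.norm_of_nonneg hk0.le, Real.norm_of_nonneg (by positivity)] at h1
  rw [one_mul, Real.norm_of_nonneg hd0, Real.norm_of_nonneg (by linarith)] at h4
  set y : ℝ := (p N : ℝ) ^ ((1 : ℝ) / 8) with hy
  have hy8 : y ^ 8 = p N := by
    rw [hy, ← Real.rpow_natCast, ← Real.rpow_mul hp0.le]
    norm_num
  have hxy : x ≤ y := by
    refine Real.rpow_le_rpow_of_exponent_le hp1 ?_
    rw [div_le_div_iff₀ hk0 (by norm_num)]
    have : (16 : ℝ) * d N ≤ k N := by exact_mod_cast h3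
    linarith
  have hlog : Real.log (p N) ≤ 4 * y ^ 2 := by
    have := Real.log_le_rpow_div hp0.le (show (0 : ℝ) < 1 / 4 by norm_num)
    have hy2 : y ^ 2 = (p N : ℝ) ^ ((1 : ℝ) / 4) := by
      rw [hy, ← Real.rpow_natCast, ← Real.rpow_mul hp0.le]
      norm_num
    rw [hy2]
    linarith
  have hy1 : 1 ≤ y := hx1.trans hxy
  have hy0 : 0 ≤ y := by linarith
  have hkle : (k N : ℝ) ≤ y * (4 * y ^ 2) :=
    h1.trans (mul_le_mul (h4.trans hxy) hlog hl hy0)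
  calc c * k N * x ≤ c * (y * (4 * y ^ 2)) * y := by gcongr
    _ = 4 * c * y ^ 4 := by ring
    _ < y * y ^ 4 := mul_lt_mul_of_pos_right (h5.trans_le hxy) (by positivity)
    _ = y ^ 5 := by ring
    _ ≤ y ^ 8 := pow_le_pow_right₀ hy1 (by norm_num)
    _ = p N := hy8

theorem eventually_mul_le_of_isLittleO (hd : ∀ N, 3 ≤ d N)
    (hdk : (fun N => (d N : ℝ) ^ 3) =o[atTop] (fun N => (k N : ℝ))) {c : ℝ} (hc : 0 < c) :
    ∀ᶠ N in atTop, (d N : ℝ) ^ 2 ≤ c * k N := by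
  filter_upwards [hdk.def hc] with N h
  have hd1 : (1 : ℝ) ≤ d N := by exact_mod_cast (show 1 ≤ d N by have := hd N; omega)
  rw [Real.norm_of_nonneg (by positivity), Real.norm_of_nonneg (by positivity)] at h
  exact (pow_le_pow_right₀ hd1 (by norm_num)).trans h

theorem tendsto_error (hk : Tendsto k atTop atTop) (hd : ∀ N, 3 ≤ d N)
    (hdk : (fun N => (d N : ℝ) ^ 3) =o[atTop] (fun N => (k N : ℝ))) {ρ : ℝ} (hρ : 1 < ρ) (c : ℝ) :
    Tendsto (fun N => Real.exp 1 * k N * (2 ^ d N + 1) / ρ ^ k N * c) atTop (𝓝 0) := by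
  have hρ0 : 0 < ρ := by linarith
  -- Of the two factors `τ ^ k` in `ρ ^ k`, one absorbs `2 ^ d` and the other the linear factor `k`.
  set τ := Real.sqrt ρ with hτ
  have hτ2 : τ * τ = ρ := Real.mul_self_sqrt hρ0.le
  have hτ1 : 1 < τ := by
    rw [hτ, Real.lt_sqrt zero_le_one]
    simpa using hρ
  have hτ0 : 0 < τ := by linarith
  have hlim : Tendsto (fun N => 2 * Real.exp 1 * ((k N : ℝ) * τ⁻¹ ^ k N)) atTop (𝓝 0) := by
    have := ((tendsto_self_mul_const_pow_of_lt_one (inv_nonneg.2 hτ0.le)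
      (inv_lt_one_of_one_lt₀ hτ1)).comp hk).const_mul (2 * Real.exp 1)
    simpa using this
  have hmain : Tendsto (fun N => Real.exp 1 * k N * (2 ^ d N + 1) / ρ ^ k N) atTop (𝓝 0) := by
    refine squeeze_zero' (Eventually.of_forall fun N => by positivity) ?_ hlim
    have hc : 0 < Real.log τ / Real.log 2 := div_pos (Real.log_pos hτ1) (Real.log_pos one_lt_two)
    filter_upwards [eventually_mul_le_of_isLittleO hd hdk hc] with N h
    have hd1 : (1 : ℝ) ≤ d N := by exact_mod_cast (show 1 ≤ d N by have := hd N; omega)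
    have h1 : (d N : ℝ) * Real.log 2 ≤ k N * Real.log τ := by
      have : (d N : ℝ) ≤ Real.log τ / Real.log 2 * k N := le_trans (by nlinarith) h
      rw [div_mul_eq_mul_div, le_div_iff₀ (Real.log_pos one_lt_two)] at this
      linarith
    have h2 : (2 : ℝ) ^ d N ≤ τ ^ k N := by
      rw [← Real.log_le_log_iff (by positivity) (by positivity), Real.log_pow, Real.log_pow]
      exact h1
    have h3 : (1 : ℝ) ≤ 2 ^ d N := one_le_pow₀ one_le_two
    rw [← hτ2, mul_pow, inv_pow, div_le_iff₀ (by positivity)]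
    calc Real.exp 1 * k N * (2 ^ d N + 1) ≤ Real.exp 1 * k N * (2 * τ ^ k N) := by
          gcongr
          linarith
      _ = _ := by field_simp
  simpa using hmain.mul_const c

end Asymptotic

theorem mainTheorem2 (k p d : ℕ → ℕ)
    (hp : ∀ N, (p N).Prime) (hd : ∀ N, 3 ≤ d N)
    (hk : Tendsto k atTop atTop)
    (hkd : (fun N => (k N : ℝ)) =o[atTop] fun N => (d N : ℝ) * Real.log (p N)) :
    ((fun N => (d N : ℝ) ^ 3) =o[atTop] (fun N => (k N : ℝ)) →
      (fun N => (d N : ℝ)) =o[atTop] (fun N => (p N : ℝ) ^ (((d N : ℝ) - 1) / (k N : ℝ))) →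
      ∀ β : ℝ, 0 < β → β < 1 → ∀ ε : ℝ, 0 < ε →
        Tendsto (fun N => randomGeneratorsProb (heisenbergGroup (p N) (d N)) (k N) fun Z =>
            typicalDistance Z β ≠ ⊤ ∧
            |(typicalDistance Z β).toReal - typicalRadius (k N) (p N) (d N)| /
              typicalRadius (k N) (p N) (d N) ≤ ε)
          atTop (𝓝 1)) ∧
    (∀ ξ : ℝ, 0 < ξ → ∀ β : ℝ, 0 < β → β < 1 → ∀ᶠ N in atTop,
      ∀ Z : Multiset (heisenbergGroup (p N) (d N)), Multiset.card Z = k N →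
        ENNReal.ofReal (typicalRadius (k N) (p N) (d N) * (1 - ξ)) ≤ typicalDistance Z β) := by
  have hx := tendsto_rpow_div_atTop hp hd hk hkd
  have hd1 : ∀ N, 1 ≤ d N := fun N => le_trans (by norm_num) (hd N)
  have hr0 : ∀ N, 1 ≤ k N → 0 < typicalRadius (k N) (p N) (d N) := by
    intro N hN
    have := Real.exp_pos 1
    have h1 : (0 : ℝ) < k N := by exact_mod_cast hN
    have h2 := zero_lt_one.trans_le (one_le_rpow_div (k := k N) (hp N) (hd1 N))
    unfold typicalRadius
    positivity
  have lower : ∀ ξ : ℝ, 0 < ξ → ∀ β : ℝ, 0 < β → β < 1 → ∀ᶠ N in atTop,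
      ∀ Z : Multiset (heisenbergGroup (p N) (d N)), Multiset.card Z = k N →
        ENNReal.ofReal (typicalRadius (k N) (p N) (d N) * (1 - ξ)) ≤ typicalDistance Z β := by
    intro ξ hξ0 β hβ0 hβ1
    -- For `ξ ≥ 1` the claimed bound is not positive.
    rcases lt_or_ge ξ 1 with hξ1 | hξ1
    · have hpow : Tendsto (fun N => (1 - ξ / 2) ^ k N) atTop (𝓝 0) :=
        (tendsto_pow_atTop_nhds_zero_of_lt_one (by linarith) (by linarith)).comp hk
      filter_upwards [hk.eventually_ge_atTop 1, hpow.eventually_lt_const hβ0,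
        hx.eventually_ge_atTop (2 * Real.exp 1 / ξ)] with N h1 h2 h3 Z hZ
      have : Fact (p N).Prime := ⟨hp N⟩
      rw [div_le_iff₀' hξ0] at h3
      exact le_typicalDistance hξ0 hξ1 h1 (one_le_rpow_div (hp N) (hd1 N))
        (pow_rpow_div_eq h1 (hd1 N)) h3 h2 Z hZ
    · filter_upwards [hk.eventually_ge_atTop 1] with N h1 Z _
      rw [ENNReal.ofReal_of_nonpos (mul_nonpos_of_nonneg_of_nonpos (hr0 N h1).le (by linarith))]
      exact zero_le
  refine ⟨fun hdk hdx β hβ0 hβ1 ε hε => ?_, lower⟩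
  have he := Real.exp_pos 1
  set δ := ε / (8 * Real.exp 1) with hδ
  have hδ0 : 0 < δ := by positivity
  have hkd16 : ∀ᶠ N in atTop, 16 * d N ≤ k N := by
    filter_upwards [eventually_mul_le_of_isLittleO hd hdk (show (0 : ℝ) < 1 / 16 by norm_num)]
      with N h
    have h1 : (1 : ℝ) ≤ d N := by exact_mod_cast hd1 N
    have : (16 : ℝ) * d N ≤ k N := by nlinarith
    exact_mod_cast this
  have hlim : Tendsto (fun N => 1 - Real.exp 1 * k N * (2 ^ d N + 1) / (1 + ε / 2) ^ k N *
      (β / (1 - β))) atTop (𝓝 1) := by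
    have := (tendsto_error hk hd hdk (show 1 < 1 + ε / 2 by linarith) (β / (1 - β))).const_sub 1
    rwa [sub_zero] at this
  refine tendsto_of_tendsto_of_tendsto_of_le_of_le' hlim tendsto_const_nhds ?_ ?_
  · filter_upwards [hk.eventually_ge_atTop 1, hkd16,
      eventually_mul_le_of_isLittleO hd hdk (show 0 < δ / 64 by positivity),
      hdx.def (show 0 < δ / 2 by positivity), hx.eventually_ge_atTop (4 * Real.exp 1 / ε),
      eventually_mul_lt_prime hp hd hk hkd hkd16 hdx (show 0 < 1 + ε by linarith),
      lower ε hε β hβ0 hβ1] with N h1 h2 h3 h4 h5 h6 h7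
    have : Fact (p N).Prime := ⟨hp N⟩
    have hx1 := one_le_rpow_div (k := k N) (hp N) (hd1 N)
    rw [div_le_iff₀' hε] at h5
    rw [Real.norm_of_nonneg (Nat.cast_nonneg _), Real.norm_of_nonneg (by linarith)] at h4
    refine (le_randomGeneratorsProb_typicalRadius hε hδ hβ0 hβ1 (hd N) hx1
      -- The upper bound holds with high probability; the deterministic lower bound supplies the
      -- other side for every `Z`.
      (pow_rpow_div_eq h1 (hd1 N)) h2 (by linarith) (by linarith) h5 h6).trans
      (randomGeneratorsProb_mono fun Z hZ hle => ?_)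
    have hlow := h7 Z hZ
    have hr := hr0 N h1
    rw [← typicalRadius] at hle
    have htop : typicalDistance Z β ≠ ⊤ := ne_top_of_le_ne_top ENNReal.ofReal_ne_top hle
    refine ⟨htop, ?_⟩
    rw [div_le_iff₀ hr, abs_le]
    have hup := ENNReal.toReal_le_of_le_ofReal (by positivity) hle
    have hdown := (ENNReal.ofReal_le_iff_le_toReal htop).1 hlow
    constructor <;> linarith
  · refine Eventually.of_forall fun N => ?_
    have : Fact (p N).Prime := ⟨hp N⟩
    exact randomGeneratorsProb_le_one
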